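/- Let $d\ge 1$ and let $M$ be an integer $d\times d$ matrix all of whose eigenvalues are bigger than $1$ in absolute value; put $m=|\det M|$, let $M^*$ be the transposed matrix, and let $\mu$ be Lebesgue measure on $\mathbb R^d$. A set of digits for $M$ is a set $D\subset\mathbb Z^d$ of $m$ vectors, containing $\mathbf 0$, that are pairwise incongruent modulo $M\mathbb Z^d$; for $s,t\in D$ let $s\oplus t$ be the element of $D$ congruent to $s+t$ modulo $M\mathbb Z^d$. Let $D$ and $D^*$ be sets of digits for $M$ and $M^*$. Let $X^+$ be the set of the vectors $x=\sum_{j\in\mathbb Z}M^{-j}x_j$ with all $x_j\in D$ and only finitely many $x_j\neq\mathbf 0$ with $j<0$, and let $X^0\subset X^+$ be the set of the vectors that have such an expansion with only finitely many nonzero digits. Let $\widetilde U$ be the set of the vectors $u$ that have two expansions $u=\sum_{j\ge1}M^{-j}u_j=\sum_{j\ge1}M^{-j}u'_j$ with $u_j,u_j'\in D$ and $u_1\ne u_1'$, let $\widetilde X=\bigcup_{h\in X^0}\bigcup_{n\in\mathbb Z}M^n(\widetilde U+h)$, and put $$X=(X^+\setminus\widetilde X)\cup X^0 .$$ The digits $x_j$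 of $x\in X$ are those of its finite expansion if $x\in X^0$, and those of its unique expansion otherwise. Put $U=\{x\in X: x_j=\mathbf 0 \text{ for all } j\le 0\}$, $H=\{x\in X: x_j=\mathbf 0\text{ for all } j>0\}$ and $x\oplus y=\sum_{j\in\mathbb Z}M^{-j}(x_j\oplus y_j)$ for $x,y\in X$. Let $X^*$ be the space defined in the same way from $M^*$ and $D^*$, with digits $\omega_j$ of $\omega\in X^*$. For $x\in X$, $\omega\in X^*$ let $$\chi(x,\omega)=\exp\Bigl(2\pi i\sum_{j\in\mathbb Z}\langle M^{-1}x_j,\omega_{1-j}\rangle\Bigr).$$ For $f\in L^1(X)$ the Fourier transform is $\widehat f(\omega)=\frac1{\mu(U)}\int_X f(x)\overline{\chi(x,\omega)}\,d\mu(x)$, $\omega\in X^*$; for $f\in L^2(X)$ it is the limit in $L^2(X^*)$, as $l\to+\infty$, of $J_lf(\omega)=\frac1{\mu(U)}\int_{M^l(U)}f(x)\overline{\chi(x,\omega)}\,d\mu(x)$. **Proposition.** Let $f\in L^2(X)$ and $\gamma\in H$. Then $x\oplus\gamma\in X$ for almost every $x\in X$, the function $f(\cdot\oplus\gamma)$ belongs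 to $L^2(X)$, the Fourier transforms $\widehat f$ and $\widehat{f(\cdot\oplus\gamma)}$ exist in $L^2(X^*)$, and $$\widehat{f(\cdot\oplus\gamma)}(\omega)=\widehat f(\omega)\,\chi(\gamma,\omega)\qquad\text{for almost every }\omega\in X^*.$$ If moreover $f\in L^1(X)$, then $f(\cdot\oplus\gamma)\in L^1(X)$ and, with both transforms given by the integral over $X$, the equality holds for every $\omega\in X^*$. -/

import Mathlib

open MeasureTheory Filter Topology Matrix

noncomputable section

namespace MPositive

variable {d : ℕ}

/-- A dilation matrix: an integer matrix all of whose (complex) eigenvalues exceed `1` in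
absolute value. -/
def IsDilation (M : Matrix (Fin d) (Fin d) ℤ) : Prop :=
  ∀ z : ℂ, Module.End.HasEigenvalue (Matrix.toLin' (M.map (Int.cast : ℤ → ℂ))) z → 1 < ‖z‖

/-- Congruence modulo `M` of integer vectors: the difference is in `M ℤ^d`. -/
def Congr (M : Matrix (Fin d) (Fin d) ℤ) (l k : Fin d → ℤ) : Prop :=
  ∃ s : Fin d → ℤ, l - k = M *ᵥ s

/-- A set of digits for `M`: `|det M|` pairwise incongruent integer vectors, one of them zero. -/
structure IsDigitSet (M : Matrix (Fin d) (Fin d) ℤ) (D : Finset (Fin d → ℤ)) : Prop where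
  zero_mem : (0 : Fin d → ℤ) ∈ D
  card_eq : D.card = M.det.natAbs
  eq_of_congr : ∀ s ∈ D, ∀ t ∈ D, Congr M s t → s = t

/-- The real vector `M ^ n x`, for `n : ℤ`. -/
def act (M : Matrix (Fin d) (Fin d) ℤ) (n : ℤ) (x : Fin d → ℝ) : Fin d → ℝ :=
  ((M.map (Int.cast : ℤ → ℝ)) ^ n) *ᵥ x

/-- An integer vector seen as a real vector. -/
def toReal (s : Fin d → ℤ) : Fin d → ℝ := fun i => (s i : ℝ)

/-- `a` is a sequence of digits with `x = ∑_{j ∈ ℤ} M ^ (-j) a_j`, where only finitely many of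
the digits with negative index are nonzero. -/
structure IsExpansion (M : Matrix (Fin d) (Fin d) ℤ) (D : Finset (Fin d → ℤ))
    (x : Fin d → ℝ) (a : ℤ → Fin d → ℤ) : Prop where
  mem : ∀ j, a j ∈ D
  left_finite : {j : ℤ | j < 0 ∧ a j ≠ 0}.Finite
  hasSum : HasSum (fun j : ℤ => act M (-j) (toReal (a j))) x

/-- An expansion with only finitely many nonzero digits. -/
def IsFiniteExpansion (M : Matrix (Fin d) (Fin d) ℤ) (D : Finset (Fin d → ℤ))
    (x : Fin d → ℝ) (a : ℤ → Fin d → ℤ) : Prop :=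
  IsExpansion M D x a ∧ {j : ℤ | a j ≠ 0}.Finite

/-- The set `X⁺` of vectors that have an expansion. -/
def XPlus (M : Matrix (Fin d) (Fin d) ℤ) (D : Finset (Fin d → ℤ)) : Set (Fin d → ℝ) :=
  {x | ∃ a, IsExpansion M D x a}

/-- The set `X⁰` of vectors that have a finite expansion. -/
def XZero (M : Matrix (Fin d) (Fin d) ℤ) (D : Finset (Fin d → ℤ)) : Set (Fin d → ℝ) :=
  {x | ∃ a, IsFiniteExpansion M D x a}

/-- The vectors of the form `∑_{j ≥ 1} M ^ (-j) u_j` for which the first digit `u_1` is not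
determined: the overlap of the pieces `M⁻¹ (U⁺ + s)`, `s ∈ D`, where `U⁺` is the set of all the
vectors of this form. -/
def UTilde (M : Matrix (Fin d) (Fin d) ℤ) (D : Finset (Fin d → ℤ)) : Set (Fin d → ℝ) :=
  {u | ∃ a b : ℤ → Fin d → ℤ, IsExpansion M D u a ∧ IsExpansion M D u b ∧
    (∀ j ≤ 0, a j = 0) ∧ (∀ j ≤ 0, b j = 0) ∧ a 1 ≠ b 1}

/-- The exceptional set: the union of all `M ^ n (UTilde + h)`, `h ∈ X⁰`, `n ∈ ℤ`. -/
def XTilde (M : Matrix (Fin d) (Fin d) ℤ) (D : Finset (Fin d → ℤ)) : Set (Fin d → ℝ) :=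
  ⋃ h ∈ XZero M D, ⋃ n : ℤ, (fun u => act M n (u + h)) '' UTilde M D

/-- The space of `M`-positive vectors. -/
def X (M : Matrix (Fin d) (Fin d) ℤ) (D : Finset (Fin d → ℤ)) : Set (Fin d → ℝ) :=
  (XPlus M D \ XTilde M D) ∪ XZero M D

open Classical in
/-- The digits `x_j` of a vector `x`: those of its finite expansion if there is one, those of its
expansion otherwise (unique for `x ∈ X`); zero for vectors without an expansion. -/
def digits (M : Matrix (Fin d) (Fin d) ℤ) (D : Finset (Fin d → ℤ)) (x : Fin d → ℝ) :
    ℤ → Fin d → ℤ :=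
  if h : ∃ a, IsFiniteExpansion M D x a then h.choose
  else if h : ∃ a, IsExpansion M D x a then h.choose
  else 0

/-- The analogue of the unit interval: no digits with index `≤ 0`. -/
def U (M : Matrix (Fin d) (Fin d) ℤ) (D : Finset (Fin d → ℤ)) : Set (Fin d → ℝ) :=
  {x | x ∈ X M D ∧ ∀ j ≤ 0, digits M D x j = 0}

/-- The analogue of the nonnegative integers: no digits with index `> 0`. -/
def H (M : Matrix (Fin d) (Fin d) ℤ) (D : Finset (Fin d → ℤ)) : Set (Fin d → ℝ) :=
  {x | x ∈ X M D ∧ ∀ j > 0, digits M D x j = 0}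

open Classical in
/-- Addition of digits modulo `M`: the element of `D` congruent to `s + t`. -/
def digitAdd (M : Matrix (Fin d) (Fin d) ℤ) (D : Finset (Fin d → ℤ)) (s t : Fin d → ℤ) :
    Fin d → ℤ :=
  if h : ∃ r ∈ D, Congr M (s + t) r then h.choose else 0

/-- The termwise addition `x ⊕ y = ∑_{j ∈ ℤ} M ^ (-j) (x_j ⊕ y_j)`. -/
def oplus (M : Matrix (Fin d) (Fin d) ℤ) (D : Finset (Fin d → ℤ)) (x y : Fin d → ℝ) :
    Fin d → ℝ :=
  ∑' j : ℤ, act M (-j) (toReal (digitAdd M D (digits M D x j) (digits M D y j)))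

/-- `χ(x, ω) = exp (2πi ∑_{j ∈ ℤ} ⟨M⁻¹ x_j, ω_{1-j}⟩)`, where `x_j` are the digits of `x` with
respect to `(M, D)` and `ω_j` those of `ω` with respect to `(Mᵀ, D')`. Only finitely many terms
of the sum are nonzero. -/
def chi (M : Matrix (Fin d) (Fin d) ℤ) (D D' : Finset (Fin d → ℤ)) (x ω : Fin d → ℝ) : ℂ :=
  Complex.exp (2 * Real.pi * Complex.I *
    ((∑' j : ℤ, act M (-1) (toReal (digits M D x j)) ⬝ᵥ toReal (digits Mᵀ D' ω (1 - j)) : ℝ) : ℂ))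

/-- The integral `(1 / μ(U)) ∫_S f(x) conj χ(x, ω) dμ(x)` over a set `S`. -/
def fourierOn (M : Matrix (Fin d) (Fin d) ℤ) (D D' : Finset (Fin d → ℤ)) (S : Set (Fin d → ℝ))
    (f : (Fin d → ℝ) → ℂ) (ω : Fin d → ℝ) : ℂ :=
  (1 / ((volume.real (U M D) : ℝ) : ℂ)) *
    ∫ x in S, f x * (starRingEnd ℂ) (chi M D D' x ω)

/-- The Fourier transform of a function in `L¹(X)`. -/
def fourierL1 (M : Matrix (Fin d) (Fin d) ℤ) (D D' : Finset (Fin d → ℤ))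
    (f : (Fin d → ℝ) → ℂ) (ω : Fin d → ℝ) : ℂ :=
  fourierOn M D D' (X M D) f ω

/-- The truncated Fourier transform `J_l f`: the integral over `M ^ l (U)`. -/
def truncFourier (M : Matrix (Fin d) (Fin d) ℤ) (D D' : Finset (Fin d → ℤ)) (l : ℕ)
    (f : (Fin d → ℝ) → ℂ) (ω : Fin d → ℝ) : ℂ :=
  fourierOn M D D' (act M (l : ℤ) '' U M D) f ω

/-- `F` is (a representative of) the Fourier transform of `f ∈ L²(X)`: the limit of `J_l f` in
`L²(X*)`, where `X*` is the space of `Mᵀ`-positive vectors with digits `D'`. -/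
def IsFourierL2 (M : Matrix (Fin d) (Fin d) ℤ) (D D' : Finset (Fin d → ℤ))
    (f F : (Fin d → ℝ) → ℂ) : Prop :=
  MemLp F 2 (volume.restrict (X Mᵀ D')) ∧
  Tendsto (fun l : ℕ => eLpNorm (fun ω => truncFourier M D D' l f ω - F ω) 2
    (volume.restrict (X Mᵀ D'))) atTop (𝓝 0)

end MPositive

end

noncomputable section

namespace MPositive

variable {d : ℕ}

/-! Fix a level n and sort the vectors of X by their digits of index at most n. Up to a null set
this splits X into countably many disjoint cells, one for each finite word h, each a translate of
one compact set, `tail M D n`. The digits of γ form a word g with n = 0. On the cell of h the map x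
↦ x ⊕ γ is an ordinary translation onto the cell of h ⊕ g, and h ↦ h ⊕ g permutes the words; hence x
↦ x ⊕ γ preserves Lebesgue measure on X (`map_shift`).

The cells overlap in a null set because there is no room for more: `tail M D 0` is covered by m
translates of its image under the inverse of M, and the volumes of these translates add up to
exactly its own (`volume_UTilde`). So almost every vector has a unique expansion, and the digits of
x ⊕ γ are almost everywhere the termwise sums. The pairing of M s with an integer vector is an
integer, so χ(x ⊕ γ, ω) = χ(x, ω) χ(γ, ω), and a change of variables gives the formula for the
integral transform at every ω (`coeff_comp_shift`).

For L², J_l f is the integral transform of f cut off to `tail M D (-l)`. It depends only on the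
digits of ω of index at most l, and its values are inner products of the cut-off f with cut-off
characters, which are orthogonal. Bessel's inequality bounds the transform with a constant
independent of l (`exists_eLpNorm_fourierL1_le`), so J_l f is Cauchy. For large l the cut-off
commutes with the shift; the formula then holds for J_l and passes to the limit. -/

/-! ### Dilation matrices: spectrum and determinant -/

theorem IsDilation.one_lt_norm_of_mem_spectrum {M : Matrix (Fin d) (Fin d) ℤ} (hM : IsDilation M)
    {z : ℂ} (hz : z ∈ spectrum ℂ (M.map (Int.cast : ℤ → ℂ))) : 1 < ‖z‖ := by
  refine hM z ?_
  rwa [Module.End.hasEigenvalue_iff_mem_spectrum, Matrix.spectrum_toLin']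

theorem isDilation_of_spectrum {M : Matrix (Fin d) (Fin d) ℤ}
    (h : ∀ z ∈ spectrum ℂ (M.map (Int.cast : ℤ → ℂ)), 1 < ‖z‖) : IsDilation M := by
  intro z hz
  refine h z ?_
  rwa [Module.End.hasEigenvalue_iff_mem_spectrum, Matrix.spectrum_toLin'] at hz

theorem IsDilation.transpose {M : Matrix (Fin d) (Fin d) ℤ} (hM : IsDilation M) :
    IsDilation Mᵀ := by
  refine isDilation_of_spectrum fun z hz => hM.one_lt_norm_of_mem_spectrum ?_
  rw [spectrum.mem_iff, Matrix.isUnit_iff_isUnit_det] at hz ⊢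
  rw [← Matrix.det_transpose]
  convert hz using 3
  simp [Matrix.transpose_sub, Matrix.transpose_map, Matrix.algebraMap_eq_diagonal]

theorem det_map_intCast {R : Type*} [CommRing R] (M : Matrix (Fin d) (Fin d) ℤ) :
    (M.map (Int.cast : ℤ → R)).det = (M.det : R) :=
  ((Int.castRingHom R).map_det M).symm

theorem IsDilation.det_ne_zero {M : Matrix (Fin d) (Fin d) ℤ} (hM : IsDilation M) :
    M.det ≠ 0 := by
  intro h0
  have : (0 : ℂ) ∈ spectrum ℂ (M.map (Int.cast : ℤ → ℂ)) := by
    rw [spectrum.zero_mem_iff, Matrix.isUnit_iff_isUnit_det, det_map_intCast, h0]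
    simp
  have := hM.one_lt_norm_of_mem_spectrum this
  norm_num at this

theorem IsDilation.isUnit_det {M : Matrix (Fin d) (Fin d) ℤ} (hM : IsDilation M) :
    IsUnit (M.map (Int.cast : ℤ → ℝ)).det := by
  rw [det_map_intCast, isUnit_iff_ne_zero]
  exact_mod_cast hM.det_ne_zero

/-! ### Decay of the negative powers of M -/

section Norms

attribute [local instance] Matrix.linftyOpNormedAddCommGroup Matrix.linftyOpNormedSpace
  Matrix.linftyOpNormedRing Matrix.linftyOpNormedAlgebra

/-- By Gelfand's formula the norms are eventually below a geometric sequence of ratio r < 1. -/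
theorem summable_norm_pow_of_spectralRadius_lt_one {A : Type*} [NormedRing A] [NormedAlgebra ℂ A]
    [CompleteSpace A] {a : A} (ha : spectralRadius ℂ a < 1) : Summable fun n : ℕ => ‖a ^ n‖ := by
  obtain ⟨r, hr, hr1⟩ := ENNReal.lt_iff_exists_nnreal_btwn.1 ha
  have hr1 : r < 1 := by exact_mod_cast hr1
  have h := (spectrum.pow_nnnorm_pow_one_div_tendsto_nhds_spectralRadius a).eventually_lt_const hr
  have h2 : ∀ᶠ n : ℕ in atTop, ‖a ^ n‖ ≤ (r : ℝ) ^ n := by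
    filter_upwards [h, eventually_gt_atTop 0] with n hn hn0
    have h3 := ENNReal.rpow_le_rpow hn.le (z := (n : ℝ)) (by positivity)
    rw [← ENNReal.rpow_mul, one_div, inv_mul_cancel₀ (by positivity), ENNReal.rpow_one,
      ENNReal.rpow_natCast] at h3
    exact_mod_cast h3
  refine Summable.of_norm_bounded_eventually_nat
    (summable_geometric_of_lt_one r.coe_nonneg (by exact_mod_cast hr1)) ?_
  simpa using h2

/-- Gelfand's formula lives over ℂ; complexifying the matrix does not change its `linfty` operator
norm, and the spectrum of the inverse consists of inverses of eigenvalues of M. -/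
theorem IsDilation.summable_norm_inv_pow {M : Matrix (Fin d) (Fin d) ℤ} (hM : IsDilation M) :
    Summable fun n : ℕ => ‖(M.map (Int.cast : ℤ → ℝ))⁻¹ ^ n‖ := by
  set A : Matrix (Fin d) (Fin d) ℝ := (M.map (Int.cast : ℤ → ℝ))⁻¹ with hA
  -- For d = 0 the matrix algebra is trivial and the spectrum is empty, so no spectral value attains
  -- the radius.
  rcases isEmpty_or_nonempty (Fin d) with he | hne
  · refine summable_zero.congr fun n => ?_
    rw [Subsingleton.elim (A ^ n) 0, norm_zero]
  set B : Matrix (Fin d) (Fin d) ℂ := M.map (Int.cast : ℤ → ℂ) with hB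
  have hBu : IsUnit B.det := by
    rw [hB, det_map_intCast, isUnit_iff_ne_zero]
    exact_mod_cast hM.det_ne_zero
  have hBA : B⁻¹ = A.map (algebraMap ℝ ℂ) := by
    refine Matrix.inv_eq_right_inv ?_
    have h1 : B = (M.map (Int.cast : ℤ → ℝ)).map (algebraMap ℝ ℂ) := by
      ext i j; simp [hB]
    rw [h1, ← Matrix.map_mul, hA, Matrix.mul_nonsing_inv _ hM.isUnit_det]
    simp
  have hnorm : ∀ n : ℕ, ‖A ^ n‖ = ‖B⁻¹ ^ n‖ := by
    intro n
    have h1 : B⁻¹ ^ n = (A ^ n).map (algebraMap ℝ ℂ) := by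
      rw [hBA]
      exact ((RingHom.mapMatrix (algebraMap ℝ ℂ)).map_pow A n).symm
    rw [h1, Matrix.linfty_opNorm_def, Matrix.linfty_opNorm_def]
    simp
  simp_rw [hnorm]
  refine summable_norm_pow_of_spectralRadius_lt_one ?_
  obtain ⟨z, hz, hzr⟩ := spectrum.exists_nnnorm_eq_spectralRadius B⁻¹
  rw [← hzr]
  have hBunit : IsUnit B := (Matrix.isUnit_iff_isUnit_det _).2 hBu
  have hz0 : z ≠ 0 := by
    rintro rfl
    rw [spectrum.zero_mem_iff] at hz
    exact hz ((Matrix.isUnit_nonsing_inv_iff).2 hBunit)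
  have hzB : z⁻¹ ∈ spectrum ℂ B := by
    refine (spectrum.inv_mem_iff (r := (Units.mk0 z hz0)⁻¹) (a := hBunit.unit)).2 ?_
    rwa [inv_inv, Matrix.coe_units_inv]
  have := hM.one_lt_norm_of_mem_spectrum hzB
  rw [norm_inv, one_lt_inv₀ (by positivity)] at this
  exact_mod_cast this

theorem norm_act_neg_natCast_le (M : Matrix (Fin d) (Fin d) ℤ) (k : ℕ) (x : Fin d → ℝ) :
    ‖act M (-(k : ℤ)) x‖ ≤ ‖(M.map (Int.cast : ℤ → ℝ))⁻¹ ^ k‖ * ‖x‖ := by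
  rw [act, Matrix.zpow_neg_natCast, ← Matrix.inv_pow']
  exact Matrix.linfty_opNorm_mulVec _ _

theorem IsDilation.exists_bound {M : Matrix (Fin d) (Fin d) ℤ} (hM : IsDilation M)
    (D : Finset (Fin d → ℤ)) : ∃ u : ℕ → ℝ, Summable u ∧
      ∀ k : ℕ, ∀ s ∈ D, ‖act M (-(k : ℤ)) (toReal s)‖ ≤ u k := by
  obtain ⟨C, hC⟩ := (D.finite_toSet.image fun s => ‖toReal s‖).bddAbove
  refine ⟨_, hM.summable_norm_inv_pow.mul_right C, fun k s hs => ?_⟩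
  refine (norm_act_neg_natCast_le M k _).trans ?_
  exact mul_le_mul_of_nonneg_left (hC ⟨s, hs, rfl⟩) (norm_nonneg _)

end Norms

/-! ### The action of powers of M and its effect on volume -/

section Act

variable {M : Matrix (Fin d) (Fin d) ℤ} {D : Finset (Fin d → ℤ)}

theorem act_add (n : ℤ) (x y : Fin d → ℝ) : act M n (x + y) = act M n x + act M n y :=
  Matrix.mulVec_add _ _ _

theorem act_sub (n : ℤ) (x y : Fin d → ℝ) : act M n (x - y) = act M n x - act M n y :=
  Matrix.mulVec_sub _ _ _

@[simp] theorem act_zero_right (n : ℤ) : act M n 0 = 0 := Matrix.mulVec_zero _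

@[simp] theorem act_zero_left (x : Fin d → ℝ) : act M 0 x = x := by simp [act]

theorem IsDilation.act_act (hM : IsDilation M) (m n : ℤ) (x : Fin d → ℝ) :
    act M m (act M n x) = act M (m + n) x := by
  rw [act, act, act, Matrix.mulVec_mulVec, Matrix.zpow_add hM.isUnit_det]

theorem continuous_act (n : ℤ) : Continuous (act M n) :=
  continuous_const.matrix_mulVec continuous_id

theorem IsDilation.volume_image_act (hM : IsDilation M) (hD : IsDigitSet M D)
    (S : Set (Fin d → ℝ)) : volume S = D.card * volume (act M (-1) '' S) := by
  have h := Measure.addHaar_image_linearMap (volume : Measure (Fin d → ℝ))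
    (Matrix.toLin' (M.map (Int.cast : ℤ → ℝ))) (act M (-1) '' S)
  have h1 : (Matrix.toLin' (M.map (Int.cast : ℤ → ℝ))) '' (act M (-1) '' S) = S := by
    rw [Set.image_image]
    have : ∀ x, (Matrix.toLin' (M.map (Int.cast : ℤ → ℝ))) (act M (-1) x) = x := by
      intro x
      have := hM.act_act 1 (-1) x
      simpa [act] using this
    simp [this]
  rw [h1, LinearMap.det_toLin', det_map_intCast] at h
  rw [h, hD.card_eq]
  congr 1
  rw [← Int.cast_abs, Int.abs_eq_natAbs, Int.cast_natCast, ENNReal.ofReal_natCast]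

@[simp] theorem toReal_zero : toReal (0 : Fin d → ℤ) = 0 := by ext; simp [toReal]

theorem toReal_add (s t : Fin d → ℤ) : toReal (s + t) = toReal s + toReal t := by
  ext; simp [toReal]

theorem toReal_sub (s t : Fin d → ℤ) : toReal (s - t) = toReal s - toReal t := by
  ext; simp [toReal]

theorem toReal_mulVec (s : Fin d → ℤ) : toReal (M *ᵥ s) = act M 1 (toReal s) := by
  ext i
  simp [toReal, act, Matrix.mulVec, dotProduct]

end Act

/-! ### Digits as residues modulo M -/

section Residues

variable {M : Matrix (Fin d) (Fin d) ℤ} {D : Finset (Fin d → ℤ)}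

theorem IsDilation.index_range (hM : IsDilation M) :
    (LinearMap.range M.mulVecLin).toAddSubgroup.index = M.det.natAbs := by
  have hinj : Function.Injective M.mulVecLin := by
    rw [← LinearMap.ker_eq_bot, LinearMap.ker_eq_bot']
    intro v hv
    exact Matrix.eq_zero_of_mulVec_eq_zero hM.det_ne_zero hv
  let e := LinearEquiv.ofInjective M.mulVecLin hinj
  rw [AddSubgroup.index_eq_natAbs_det (Pi.basisFun ℤ (Fin d)) _
    ((Pi.basisFun ℤ (Fin d)).map e)]
  congr 1
  rw [Module.Basis.det_apply]
  congr 1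
  ext i j
  simp only [Module.Basis.toMatrix_apply, Module.Basis.map_apply, Pi.basisFun_apply,
    Pi.basisFun_repr]
  change (M *ᵥ Pi.single j 1) i = M i j
  simp

theorem congr_iff_mem_range {s t : Fin d → ℤ} :
    Congr M s t ↔ s - t ∈ LinearMap.range M.mulVecLin := by
  simp only [Congr, LinearMap.mem_range, Matrix.mulVecLin_apply, eq_comm]

theorem Congr.symm {s t : Fin d → ℤ} (h : Congr M s t) : Congr M t s := by
  rw [congr_iff_mem_range] at h ⊢
  simpa using neg_mem h

theorem Congr.trans {s t r : Fin d → ℤ} (h : Congr M s t) (h' : Congr M t r) : Congr M s r := by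
  rw [congr_iff_mem_range] at h h' ⊢
  simpa using add_mem h h'

/-- The digits inject into the quotient by the range of M, whose order is |det M|, the number of
digits; an injection between finite sets of equal size is onto. -/
theorem IsDigitSet.exists_congr (hM : IsDilation M) (hD : IsDigitSet M D) (s : Fin d → ℤ) :
    ∃ r ∈ D, Congr M s r := by
  set N := (LinearMap.range M.mulVecLin).toAddSubgroup with hN
  have hcard : Nat.card ((Fin d → ℤ) ⧸ N) = D.card := by
    rw [hD.card_eq, ← hM.index_range]; rfl
  have hpos : 0 < D.card := Finset.card_pos.2 ⟨0, hD.zero_mem⟩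
  have : Finite ((Fin d → ℤ) ⧸ N) := Nat.finite_of_card_ne_zero (by omega)
  have hq : ∀ a b : Fin d → ℤ, (a : (Fin d → ℤ) ⧸ N) = b ↔ Congr M a b := by
    intro a b
    rw [eq_comm, QuotientAddGroup.eq, congr_iff_mem_range, neg_add_eq_sub]
    rfl
  have hinj : Function.Injective fun r : D => ((r : Fin d → ℤ) : (Fin d → ℤ) ⧸ N) := by
    intro a b hab
    exact Subtype.ext (hD.eq_of_congr _ a.2 _ b.2 ((hq _ _).1 hab))
  have hbij := (Nat.bijective_iff_injective_and_card _).2 ⟨hinj, by simp [hcard]⟩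
  obtain ⟨r, hr⟩ := hbij.2 (s : (Fin d → ℤ) ⧸ N)
  exact ⟨r, r.2, ((hq _ _).1 hr).symm⟩

theorem IsDigitSet.digitAdd_spec (hM : IsDilation M) (hD : IsDigitSet M D) (s t : Fin d → ℤ) :
    digitAdd M D s t ∈ D ∧ Congr M (s + t) (digitAdd M D s t) := by
  have h := hD.exists_congr hM (s + t)
  rw [digitAdd, dif_pos h]
  exact h.choose_spec

theorem IsDigitSet.digitAdd_zero (hM : IsDilation M) (hD : IsDigitSet M D) {s : Fin d → ℤ}
    (hs : s ∈ D) : digitAdd M D s 0 = s := by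
  have h := hD.digitAdd_spec hM s 0
  rw [add_zero] at h
  exact (hD.eq_of_congr _ hs _ h.1 h.2).symm

theorem IsDigitSet.digitAdd_left_injective (hM : IsDilation M) (hD : IsDigitSet M D)
    {s s' t : Fin d → ℤ} (hs : s ∈ D) (hs' : s' ∈ D) (h : digitAdd M D s t = digitAdd M D s' t) :
    s = s' := by
  have h1 := (hD.digitAdd_spec hM s t).2
  rw [h] at h1
  have h2 := h1.trans (hD.digitAdd_spec hM s' t).2.symm
  refine hD.eq_of_congr _ hs _ hs' ?_
  rw [congr_iff_mem_range] at h2 ⊢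
  simpa using h2

/-- Translation by `t` permutes the digits. -/
theorem IsDigitSet.exists_digitAdd_eq (hM : IsDilation M) (hD : IsDigitSet M D)
    {r : Fin d → ℤ} (hr : r ∈ D) (t : Fin d → ℤ) : ∃ s ∈ D, digitAdd M D s t = r := by
  obtain ⟨s, hs, h⟩ := hD.exists_congr hM (r - t)
  refine ⟨s, hs, ?_⟩
  have h1 := hD.digitAdd_spec hM s t
  refine hD.eq_of_congr _ h1.1 _ hr (h1.2.symm.trans ?_)
  rw [congr_iff_mem_range] at h ⊢
  have := neg_mem h
  rwa [show -(r - t - s) = s + t - r by abel] at this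

end Residues

/-! ### Expansions, their uniqueness, and compactness of the tails -/

section

variable {M : Matrix (Fin d) (Fin d) ℤ} {D : Finset (Fin d → ℤ)} {x y : Fin d → ℝ}
  {a b : ℤ → Fin d → ℤ}

/-- The vector `∑ M ^ (-j) a_j`. -/
def series (M : Matrix (Fin d) (Fin d) ℤ) (a : ℤ → Fin d → ℤ) : Fin d → ℝ :=
  ∑' j : ℤ, act M (-j) (toReal (a j))

theorem IsExpansion.series_eq (ha : IsExpansion M D x a) : series M a = x := ha.hasSum.tsum_eq

theorem IsDilation.isExpansion_series (hM : IsDilation M) (ha : ∀ j, a j ∈ D)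
    (hfin : {j : ℤ | j < 0 ∧ a j ≠ 0}.Finite) : IsExpansion M D (series M a) a := by
  refine ⟨ha, hfin, Summable.hasSum ?_⟩
  obtain ⟨u, hu, hb⟩ := hM.exists_bound D
  refine Summable.of_nat_of_neg (hu.of_norm_bounded fun k => hb k _ (ha _)) ?_
  refine summable_of_hasFiniteSupport ?_
  have h1 : {k : ℕ | a (-(k : ℤ)) ≠ 0}.Finite := by
    have h2 : {j : ℤ | j ≤ 0 ∧ a j ≠ 0}.Finite := by
      refine (hfin.union (Set.finite_singleton 0)).subset ?_
      rintro j ⟨hj, hj'⟩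
      rcases hj.lt_or_eq with h | h
      · exact Or.inl ⟨h, hj'⟩
      · exact Or.inr h
    refine (h2.preimage (f := fun k : ℕ => -(k : ℤ)) ?_).subset ?_
    · intro p _ q _ h
      simpa using h
    · intro k hk
      exact ⟨by simp, hk⟩
  refine h1.subset fun k hk => ?_
  contrapose! hk
  simp only [Set.mem_ofPred_eq, not_not] at hk
  simp [hk]

theorem IsExpansion.finite_lt (ha : IsExpansion M D x a) (n : ℤ) :
    {j : ℤ | j < n ∧ a j ≠ 0}.Finite := by
  refine (ha.left_finite.union (Set.finite_Ico 0 n)).subset ?_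
  rintro j ⟨hj, hj'⟩
  by_cases h : j < 0
  · exact Or.inl ⟨h, hj'⟩
  · exact Or.inr ⟨not_lt.1 h, hj⟩

theorem IsExpansion.exists_lower_bound (ha : IsExpansion M D x a) :
    ∃ N : ℤ, ∀ j ≤ N, a j = 0 := by
  obtain ⟨N, hN⟩ := ha.left_finite.bddBelow
  refine ⟨min N 0 - 1, fun j hj => ?_⟩
  by_contra h
  have := hN (⟨by omega, h⟩ : j < 0 ∧ a j ≠ 0)
  omega

theorem IsExpansion.act_shift (hM : IsDilation M) (ha : IsExpansion M D x a) (n : ℤ) :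
    IsExpansion M D (act M n x) (fun j => a (j + n)) := by
  refine ⟨fun j => ha.mem _, ?_, ?_⟩
  · refine ((ha.finite_lt n).preimage (f := fun j : ℤ => j + n) ?_).subset ?_
    · intro p _ q _ h
      simpa using h
    · rintro j ⟨hj, hj'⟩
      exact ⟨by simpa using hj, hj'⟩
  · have h := ha.hasSum.map (Matrix.mulVecLin ((M.map (Int.cast : ℤ → ℝ)) ^ n))
      (continuous_act n)
    rw [← (Equiv.addRight n).hasSum_iff] at h
    convert h using 2 with j
    · change act M (-j) _ = act M n (act M (-(j + n)) _)
      rw [hM.act_act]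
      simp
    · rfl

/-- Expansions with disjoint supports can be added. -/
theorem IsExpansion.add_of_disjoint (ha : IsExpansion M D x a) (hb : IsExpansion M D y b)
    (h : ∀ j, a j = 0 ∨ b j = 0) : IsExpansion M D (x + y) (a + b) := by
  refine ⟨fun j => ?_, (ha.left_finite.union hb.left_finite).subset ?_, ?_⟩
  · rcases h j with h | h <;> simp [h, ha.mem j, hb.mem j]
  · rintro j ⟨hj, hj'⟩
    by_cases h0 : a j = 0
    · exact Or.inr ⟨hj, by simpa [h0] using hj'⟩
    · exact Or.inl ⟨hj, h0⟩
  · convert ha.hasSum.add hb.hasSum using 2 with j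
    rw [Pi.add_apply, toReal_add, act_add]

/-- The digits with index at most `n`. -/
def head (n : ℤ) (a : ℤ → Fin d → ℤ) : ℤ → Fin d → ℤ := fun j => if j ≤ n then a j else 0

/-- The digits with index greater than `n`. -/
def rest (n : ℤ) (a : ℤ → Fin d → ℤ) : ℤ → Fin d → ℤ := fun j => if j ≤ n then 0 else a j

theorem head_add_rest (n : ℤ) (a : ℤ → Fin d → ℤ) : head n a + rest n a = a := by
  ext j : 1
  by_cases h : j ≤ n <;> simp [head, rest, h]

theorem IsExpansion.head_spec (hM : IsDilation M) (hD : IsDigitSet M D) (ha : IsExpansion M D x a)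
    (n : ℤ) : IsFiniteExpansion M D (series M (head n a)) (head n a) := by
  refine ⟨hM.isExpansion_series (fun j => ?_) (ha.left_finite.subset ?_),
    (ha.finite_lt (n + 1)).subset ?_⟩
  · by_cases h : j ≤ n <;> simp [head, h, ha.mem j, hD.zero_mem]
  · rintro j ⟨hj, hj'⟩
    refine ⟨hj, fun h => hj' ?_⟩
    simp [head, h]
  · intro j hj
    by_cases h : j ≤ n <;> simp [head, h] at hj
    exact ⟨by omega, hj⟩

theorem IsExpansion.rest_spec (hM : IsDilation M) (hD : IsDigitSet M D) (ha : IsExpansion M D x a)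
    (n : ℤ) : IsExpansion M D (x - series M (head n a)) (rest n a) := by
  have h : IsExpansion M D (series M (rest n a)) (rest n a) := by
    refine hM.isExpansion_series (fun j => ?_) (ha.left_finite.subset ?_)
    · by_cases h : j ≤ n <;> simp [rest, h, ha.mem j, hD.zero_mem]
    · rintro j ⟨hj, hj'⟩
      refine ⟨hj, fun h => hj' ?_⟩
      simp [rest, h]
  have h1 := (ha.head_spec hM hD n).1.add_of_disjoint h fun j => by
    by_cases h : j ≤ n <;> simp [head, rest, h]
  rw [head_add_rest] at h1
  rwa [ha.hasSum.unique h1.hasSum, add_sub_cancel_left]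

/-- Let j be the first index where the expansions differ. Removing the common head and multiplying
by the power j - 1 of M moves the disagreement to the first digit, which is the situation of
`UTilde`; the removed head, scaled likewise, is the element of `XZero`. -/
theorem IsExpansion.mem_XTilde (hM : IsDilation M) (hD : IsDigitSet M D)
    (ha : IsExpansion M D x a) (hb : IsExpansion M D x b) (hab : a ≠ b) : x ∈ XTilde M D := by
  obtain ⟨N, hN⟩ := ha.exists_lower_bound
  obtain ⟨N', hN'⟩ := hb.exists_lower_bound
  obtain ⟨j, hj, hmin⟩ := Int.exists_least_of_bdd (P := fun j => a j ≠ b j)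
    ⟨min N N', fun z hz => by
      by_contra h
      exact hz (by rw [hN z (by omega), hN' z (by omega)])⟩ (Function.ne_iff.1 hab)
  have hlt : ∀ i ≤ j - 1, a i = b i := by
    intro i hi
    by_contra h
    have := hmin i h
    omega
  have hhead : head (j - 1) a = head (j - 1) b := by
    ext i : 1
    by_cases h : i ≤ j - 1 <;> simp [head, h]
    exact hlt i h
  have ha1 := (ha.rest_spec hM hD (j - 1)).act_shift hM (j - 1)
  have hb1 := (hb.rest_spec hM hD (j - 1)).act_shift hM (j - 1)
  rw [← hhead] at hb1
  have hf := ha.head_spec hM hD (j - 1)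
  set h := series M (head (j - 1) a) with hh
  refine Set.mem_biUnion (x := act M (j - 1) h)
    ⟨_, hf.1.act_shift hM (j - 1), ?_⟩ ?_
  · refine (hf.2.preimage (f := fun i : ℤ => i + (j - 1)) ?_).subset fun i hi => hi
    intro p _ q _ hpq
    simpa using hpq
  · refine Set.mem_iUnion.2 ⟨1 - j, act M (j - 1) (x - h), ⟨_, _, ha1, hb1, ?_, ?_, ?_⟩, ?_⟩
    · intro i hi
      exact if_pos (by omega)
    · intro i hi
      exact if_pos (by omega)
    · simpa [rest] using hj
    · simp only
      rw [← act_add, hM.act_act, sub_add_cancel]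
      simp

/-- The vectors `∑_{j > n} M ^ (-j) a_j`. -/
def tail (M : Matrix (Fin d) (Fin d) ℤ) (D : Finset (Fin d → ℤ)) (n : ℤ) : Set (Fin d → ℝ) :=
  {x | ∃ a, IsExpansion M D x a ∧ ∀ j ≤ n, a j = 0}

theorem image_act_tail (hM : IsDilation M) (n k : ℤ) : act M n '' tail M D k = tail M D (k - n) := by
  have key : ∀ n k : ℤ, ∀ x ∈ tail M D k, act M n x ∈ tail M D (k - n) := by
    rintro n k x ⟨a, ha, h0⟩
    exact ⟨_, ha.act_shift hM n, fun j hj => h0 _ (by omega)⟩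
  refine Set.Subset.antisymm (Set.image_subset_iff.2 (key n k)) fun x hx => ?_
  refine ⟨act M (-n) x, by simpa using key (-n) _ x hx, ?_⟩
  rw [hM.act_act]; simp

/-- After rescaling to n = 0, this is the image of a product of finite sets, compact by Tychonoff,
under a uniformly convergent series of continuous maps. -/
theorem isCompact_tail (hM : IsDilation M) (hD : IsDigitSet M D) (n : ℤ) :
    IsCompact (tail M D n) := by
  suffices h : IsCompact (tail M D 0) by
    have := h.image (continuous_act (M := M) (-n))
    rwa [image_act_tail hM, zero_sub, neg_neg] at this
  set K : Set (ℤ → Fin d → ℤ) :=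
    Set.pi Set.univ fun j => if j ≤ 0 then {0} else (D : Set (Fin d → ℤ)) with hK
  have hKmem : ∀ a ∈ K, (∀ j, a j ∈ D) ∧ ∀ j ≤ 0, a j = 0 := by
    intro a ha
    have h2 : ∀ j ≤ 0, a j = 0 := fun j hj => by simpa [hj] using ha j trivial
    refine ⟨fun j => ?_, h2⟩
    by_cases hj : j ≤ 0
    · rw [h2 j hj]; exact hD.zero_mem
    · simpa [hj] using ha j trivial
  have hKc : IsCompact K := by
    refine isCompact_univ_pi fun j => ?_
    split_ifs
    · exact isCompact_singleton
    · exact D.finite_toSet.isCompact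
  have himg : tail M D 0 = series M '' K := by
    ext x
    constructor
    · rintro ⟨a, ha, h0⟩
      refine ⟨a, fun j _ => ?_, ha.series_eq⟩
      change a j ∈ if j ≤ 0 then {0} else (D : Set (Fin d → ℤ))
      split_ifs with hj
      · exact h0 j hj
      · exact ha.mem j
    · rintro ⟨a, ha, rfl⟩
      obtain ⟨h1, h2⟩ := hKmem a ha
      refine ⟨a, hM.isExpansion_series h1 ?_, h2⟩
      convert Set.finite_empty
      ext j
      simp only [Set.mem_ofPred_eq, Set.mem_empty_iff_false, iff_false, not_and, not_not]
      exact fun hj => h2 j hj.le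
  rw [himg]
  refine hKc.image_of_continuousOn ?_
  obtain ⟨u, hu, hb⟩ := hM.exists_bound D
  refine continuousOn_tsum (u := fun j : ℤ => if j ≤ 0 then 0 else u j.toNat) (fun j => ?_) ?_ ?_
  · refine ((continuous_act _).comp ?_).continuousOn
    exact (continuous_of_discreteTopology (f := toReal)).comp (continuous_apply j)
  · refine Summable.of_nat_of_neg (hu.norm.of_norm_bounded fun k => ?_) ?_
    · split_ifs <;> simp
    · simp
  · intro j a ha
    obtain ⟨h1, h2⟩ := hKmem a ha
    split_ifs with hj
    · simp [h2 j hj]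
    · have := hb j.toNat _ (h1 j)
      rwa [Int.toNat_of_nonneg (by omega)] at this

end

/-! ### Words, cells, and the null set of ambiguous vectors -/

section

variable {M : Matrix (Fin d) (Fin d) ℤ} {D : Finset (Fin d → ℤ)} {x y : Fin d → ℝ}
  {a b : ℤ → Fin d → ℤ}

/-- The finitely supported digit sequences without digits of index greater than `n`. -/
def Word (D : Finset (Fin d → ℤ)) (n : ℤ) : Type :=
  {h : ℤ →₀ (Fin d → ℤ) // (∀ j, h j ∈ D) ∧ ∀ j, n < j → h j = 0}

namespace Word

variable {n : ℤ}

instance : CoeFun (Word D n) fun _ => ℤ → Fin d → ℤ := ⟨fun h => h.1⟩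

instance : Countable (Word D n) := inferInstanceAs (Countable (Subtype _))

theorem ext {h h' : Word D n} (H : ∀ j, h j = h' j) : h = h' := Subtype.ext (Finsupp.ext H)

theorem mem (h : Word D n) (j : ℤ) : h j ∈ D := h.2.1 j

theorem apply_of_lt (h : Word D n) {j : ℤ} (hj : n < j) : h j = 0 := h.2.2 j hj

theorem finite (h : Word D n) : {j | h j ≠ 0}.Finite := by
  exact h.1.hasFiniteSupport

theorem isExpansion (hM : IsDilation M) (h : Word D n) : IsExpansion M D (series M h) h :=
  hM.isExpansion_series h.mem (h.finite.subset fun _ hj => hj.2)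

/-- The word with the digits `a_j`, `j ≤ n`. -/
def ofFinite (hD : IsDigitSet M D) (n : ℤ) (a : ℤ → Fin d → ℤ) (ha : ∀ j, a j ∈ D)
    (hfin : {j | head n a j ≠ 0}.Finite) : Word D n :=
  ⟨Finsupp.ofSupportFinite (head n a) hfin, fun j => by
    change head n a j ∈ D
    unfold head
    split_ifs
    exacts [ha j, hD.zero_mem], fun j hj => if_neg (by omega)⟩

end Word

/-- The vectors whose digits of index at most `n` are those of `h`. -/
def cell (M : Matrix (Fin d) (Fin d) ℤ) (D : Finset (Fin d → ℤ)) (n : ℤ)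
    (h : ℤ → Fin d → ℤ) : Set (Fin d → ℝ) :=
  {x | x - series M h ∈ tail M D n}

theorem mem_cell (hM : IsDilation M) (hD : IsDigitSet M D) {n : ℤ} (h : Word D n) :
    x ∈ cell M D n h ↔ ∃ a, IsExpansion M D x a ∧ ∀ j ≤ n, a j = h j := by
  constructor
  · rintro ⟨b, hb, hb0⟩
    refine ⟨h + b, ?_, fun j hj => by simp [hb0 j hj]⟩
    have := (h.isExpansion hM).add_of_disjoint hb fun j => by
      rcases le_or_gt j n with hj | hj
      · exact Or.inr (hb0 j hj)
      · exact Or.inl (h.apply_of_lt hj)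
    rwa [add_sub_cancel] at this
  · rintro ⟨a, ha, hah⟩
    have : head n a = h := by
      ext j : 1
      unfold head
      split_ifs with hj
      · exact hah j hj
      · exact (h.apply_of_lt (not_le.1 hj)).symm
    refine ⟨_, this ▸ ha.rest_spec hM hD n, fun j hj => if_pos hj⟩

theorem XPlus_eq_iUnion_cell (hM : IsDilation M) (hD : IsDigitSet M D) (n : ℤ) :
    XPlus M D = ⋃ h : Word D n, cell M D n h := by
  ext x
  rw [Set.mem_iUnion]
  constructor
  · rintro ⟨a, ha⟩
    refine ⟨Word.ofFinite hD n a ha.mem (ha.head_spec hM hD n).2, ?_⟩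
    rw [mem_cell hM hD]
    exact ⟨a, ha, fun j hj => (if_pos hj).symm⟩
  · rintro ⟨h, hx⟩
    obtain ⟨a, ha, -⟩ := (mem_cell hM hD h).1 hx
    exact ⟨a, ha⟩

theorem measurableSet_cell (hM : IsDilation M) (hD : IsDigitSet M D) (n : ℤ)
    (h : ℤ → Fin d → ℤ) : MeasurableSet (cell M D n h) :=
  (isCompact_tail hM hD n).measurableSet.preimage (measurable_id.sub_const _)

theorem volume_cell (n : ℤ) (h : ℤ → Fin d → ℤ) :
    volume (cell M D n h) = volume (tail M D n) := by
  have := measure_preimage_add_right volume (-series M h) (tail M D n)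
  simpa only [← sub_eq_add_neg] using! this

/-- Inclusion-exclusion for `P i` and the union of the other sets: if subadditivity loses nothing
and the measures are finite, the intersection has measure zero. -/
theorem volume_inter_eq_zero_of_sum_le {α ι : Type*} [MeasurableSpace α] {μ : Measure α}
    [DecidableEq ι] {s : Finset ι} {P : ι → Set α} (hP : ∀ i ∈ s, MeasurableSet (P i))
    (hfin : ∀ i ∈ s, μ (P i) ≠ ⊤) (hle : ∑ i ∈ s, μ (P i) ≤ μ (⋃ i ∈ s, P i))
    {i j : ι} (hi : i ∈ s) (hj : j ∈ s) (hij : i ≠ j) : μ (P i ∩ P j) = 0 := by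
  set B := ⋃ k ∈ s.erase i, P k with hB
  have hU : ⋃ k ∈ s, P k = P i ∪ B := by
    conv_lhs => rw [← Finset.insert_erase hi]
    rw [Finset.set_biUnion_insert]
  have hBm : MeasurableSet B :=
    Finset.measurableSet_biUnion _ fun k hk => hP k (Finset.mem_of_mem_erase hk)
  have hB1 : μ B ≤ ∑ k ∈ s.erase i, μ (P k) := measure_biUnion_finset_le _ _
  have hsum := Finset.add_sum_erase s (fun k => μ (P k)) hi
  have h1 := measure_union_add_inter (μ := μ) (P i) hBm
  rw [← hU] at h1
  have hUfin : μ (⋃ k ∈ s, P k) ≠ ⊤ :=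
    ((measure_biUnion_finset_le _ _).trans_lt (ENNReal.sum_lt_top.2
      fun k hk => (hfin k hk).lt_top)).ne
  have h2 : μ (⋃ k ∈ s, P k) + μ (P i ∩ B) ≤ μ (⋃ k ∈ s, P k) + 0 := by
    rw [h1, add_zero]
    refine le_trans ?_ hle
    rw [← hsum]
    gcongr
  have h3 := (ENNReal.add_le_add_iff_left hUfin).1 h2
  refine measure_mono_null (Set.inter_subset_inter_right _ ?_) (nonpos_iff_eq_zero.1 h3)
  exact Set.subset_biUnion_of_mem (u := P) (Finset.mem_coe.2 (Finset.mem_erase.2 ⟨hij.symm, hj⟩))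

theorem volume_UTilde (hM : IsDilation M) (hD : IsDigitSet M D) : volume (UTilde M D) = 0 := by
  classical
  -- The word whose only possibly nonzero digit is s, at index 1; its cell at level 1 is the piece
  -- of `tail M D 0` with first digit s.
  let w : (Fin d → ℤ) → ℤ → Fin d → ℤ := fun s => Pi.single 1 s
  have hw : ∀ s ∈ D, ∃ h : Word D 1, (h : ℤ → Fin d → ℤ) = w s := by
    intro s hs
    refine ⟨⟨Finsupp.single 1 s, fun j => ?_, fun j hj => ?_⟩, ?_⟩
    · rw [Finsupp.single_apply]
      split_ifs
      exacts [hs, hD.zero_mem]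
    · rw [Finsupp.single_apply, if_neg (by omega)]
    · exact Finsupp.single_eq_pi_single 1 s
  have hmem : ∀ s ∈ D, ∀ x, x ∈ cell M D 1 (w s) ↔
      ∃ a, IsExpansion M D x a ∧ ∀ j ≤ 1, a j = w s j := by
    intro s hs x
    obtain ⟨h, hh⟩ := hw s hs
    rw [← hh, mem_cell hM hD]
  have hmem' : ∀ a x, IsExpansion M D x a → (∀ j ≤ 0, a j = 0) → x ∈ cell M D 1 (w (a 1)) := by
    intro a x ha h0
    refine (hmem _ (ha.mem 1) x).2 ⟨a, ha, fun j hj => ?_⟩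
    by_cases h : j = 1
    · subst h; simp [w]
    · rw [h0 j (by omega)]; simp [w, h]
  have htail : tail M D 0 ⊆ ⋃ s ∈ D, cell M D 1 (w s) := by
    rintro x ⟨a, ha, h0⟩
    exact Set.mem_biUnion (Finset.mem_coe.2 (ha.mem 1)) (hmem' a x ha h0)
  have hvol : volume (tail M D 0) = D.card * volume (tail M D 1) := by
    rw [hM.volume_image_act hD, image_act_tail hM]
    rfl
  have hsub : UTilde M D ⊆ ⋃ s ∈ D, ⋃ t ∈ D.erase s, cell M D 1 (w s) ∩ cell M D 1 (w t) := by
    rintro u ⟨a, b, ha, hb, ha0, hb0, hab⟩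
    refine Set.mem_biUnion (Finset.mem_coe.2 (ha.mem 1)) (Set.mem_biUnion
      (Finset.mem_coe.2 (Finset.mem_erase.2 ⟨hab.symm, hb.mem 1⟩)) ?_)
    exact ⟨hmem' a u ha ha0, hmem' b u hb hb0⟩
  refine measure_mono_null hsub ?_
  refine (measure_biUnion_null_iff D.countable_toSet).2 fun s hs => ?_
  refine (measure_biUnion_null_iff (D.erase s).countable_toSet).2 fun t ht => ?_
  obtain ⟨hts, ht⟩ := Finset.mem_erase.1 (Finset.mem_coe.1 ht)
  refine volume_inter_eq_zero_of_sum_le (P := fun s => cell M D 1 (w s)) (s := D)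
    (fun i _ => measurableSet_cell hM hD _ _) (fun i _ => ?_) ?_ hs ht hts.symm
  · rw [volume_cell]
    exact (isCompact_tail hM hD 1).measure_ne_top
  · simp only [volume_cell, Finset.sum_const, nsmul_eq_mul]
    rw [← hvol]
    exact measure_mono htail

theorem countable_XZero : (XZero M D).Countable := by
  refine (Set.countable_range fun h : ℤ →₀ (Fin d → ℤ) => series M h).mono ?_
  rintro x ⟨a, ha, hfin⟩
  exact ⟨Finsupp.ofSupportFinite a hfin, ha.series_eq⟩

theorem volume_XTilde (hM : IsDilation M) (hD : IsDigitSet M D) : volume (XTilde M D) = 0 := by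
  refine (measure_biUnion_null_iff countable_XZero).2 fun h _ => ?_
  refine measure_iUnion_null fun n => ?_
  rw [← Set.image_image (act M n) (fun u => u + h)]
  have h1 := Measure.addHaar_image_linearMap (volume : Measure (Fin d → ℝ))
    (Matrix.mulVecLin ((M.map (Int.cast : ℤ → ℝ)) ^ n)) ((fun u => u + h) '' UTilde M D)
  refine h1.trans ?_
  rw [Set.image_add_right, measure_preimage_add_right, volume_UTilde hM hD, mul_zero]

theorem digits_spec (hx : x ∈ XPlus M D) : IsExpansion M D x (digits M D x) := by
  unfold digits
  split_ifs with h h'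
  · exact h.choose_spec.1
  · exact h'.choose_spec
  · exact absurd hx h'

theorem X_subset_XPlus : X M D ⊆ XPlus M D := by
  rintro x (hx | ⟨a, ha⟩)
  · exact hx.1
  · exact ⟨a, ha.1⟩

/-- Outside `XTilde` the choices made in `digits` are immaterial. -/
theorem IsExpansion.eq_digits (hM : IsDilation M) (hD : IsDigitSet M D) (ha : IsExpansion M D x a)
    (hx : x ∉ XTilde M D) : digits M D x = a := by
  by_contra h
  exact hx ((digits_spec ⟨a, ha⟩).mem_XTilde hM hD ha h)

theorem X_ae_eq_XPlus (hM : IsDilation M) (hD : IsDigitSet M D) :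
    X M D =ᵐ[volume] XPlus M D := by
  refine Filter.EventuallyLE.antisymm X_subset_XPlus.eventuallyLE ?_
  have := compl_mem_ae_iff.2 (volume_XTilde hM hD)
  filter_upwards [this] with x hx hxp
  exact Or.inl ⟨hxp, hx⟩

theorem ae_restrict_X (hM : IsDilation M) (hD : IsDigitSet M D) :
    ∀ᵐ x ∂volume.restrict (X M D), x ∈ XPlus M D ∧ x ∉ XTilde M D := by
  rw [Measure.restrict_congr_set (X_ae_eq_XPlus hM hD)]
  have hm : MeasurableSet (XPlus M D) := by
    rw [XPlus_eq_iUnion_cell hM hD 0]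
    exact MeasurableSet.iUnion fun h => measurableSet_cell hM hD _ _
  filter_upwards [ae_restrict_mem hm,
    ae_restrict_of_ae (compl_mem_ae_iff.2 (volume_XTilde hM hD))] with x hx hx'
  exact ⟨hx, hx'⟩

theorem ae_restrict_cell (hM : IsDilation M) (hD : IsDigitSet M D) {n : ℤ} (h : Word D n) :
    ∀ᵐ x ∂volume.restrict (cell M D n h),
      x ∈ XPlus M D ∧ x ∉ XTilde M D ∧ ∀ j ≤ n, digits M D x j = h j := by
  filter_upwards [ae_restrict_mem (measurableSet_cell hM hD n h),
    ae_restrict_of_ae (compl_mem_ae_iff.2 (volume_XTilde hM hD))] with x hx hx'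
  obtain ⟨a, ha, hah⟩ := (mem_cell hM hD h).1 hx
  exact ⟨⟨a, ha⟩, hx', fun j hj => by rw [ha.eq_digits hM hD hx', hah j hj]⟩

/-- Two distinct words give a common vector two distinct expansions, so the cells overlap only
inside the null set `XTilde`. This reduces measure statements on X to single cells. -/
theorem restrict_X_eq_sum (hM : IsDilation M) (hD : IsDigitSet M D) (n : ℤ) :
    volume.restrict (X M D) = Measure.sum fun h : Word D n => volume.restrict (cell M D n h) := by
  rw [Measure.restrict_congr_set (X_ae_eq_XPlus hM hD), XPlus_eq_iUnion_cell hM hD n]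
  refine Measure.restrict_iUnion_ae (fun h h' hne => ?_)
    fun h => (measurableSet_cell hM hD n h).nullMeasurableSet
  refine measure_mono_null ?_ (volume_XTilde hM hD)
  rintro x ⟨hx, hx'⟩
  obtain ⟨a, ha, hah⟩ := (mem_cell hM hD h).1 hx
  obtain ⟨b, hb, hbh⟩ := (mem_cell hM hD h').1 hx'
  refine ha.mem_XTilde hM hD hb fun hab => hne (Word.ext fun j => ?_)
  rcases le_or_gt j n with hj | hj
  · rw [← hah j hj, ← hbh j hj, hab]
  · rw [h.apply_of_lt hj, h'.apply_of_lt hj]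

end

/-! ### The shift by a word preserves measure -/

section

variable {M : Matrix (Fin d) (Fin d) ℤ} {D : Finset (Fin d → ℤ)} {x y : Fin d → ℝ}
  {a b : ℤ → Fin d → ℤ} {n : ℤ}

/-- Termwise addition of digit sequences. -/
def seqAdd (M : Matrix (Fin d) (Fin d) ℤ) (D : Finset (Fin d → ℤ)) (a b : ℤ → Fin d → ℤ) :
    ℤ → Fin d → ℤ :=
  fun j => digitAdd M D (a j) (b j)

theorem seqAdd_apply_of_eq_zero (hM : IsDilation M) (hD : IsDigitSet M D) {j : ℤ}
    (ha : a j ∈ D) (hb : b j = 0) : seqAdd M D a b j = a j := by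
  rw [seqAdd, hb, hD.digitAdd_zero hM ha]

/-- Termwise addition of words. -/
def Word.add (hM : IsDilation M) (hD : IsDigitSet M D) (h g : Word D n) : Word D n :=
  ⟨Finsupp.ofSupportFinite (seqAdd M D h g) ((h.finite.union g.finite).subset fun j hj => by
      by_contra hc
      simp only [Set.mem_union, Set.mem_ofPred_eq, not_or, not_not] at hc
      exact hj (by rw [seqAdd_apply_of_eq_zero hM hD (h.mem j) hc.2, hc.1])),
    fun j => (hD.digitAdd_spec hM _ _).1, fun j hj => by
      change seqAdd M D h g j = 0
      rw [seqAdd_apply_of_eq_zero hM hD (h.mem j) (g.apply_of_lt hj), h.apply_of_lt hj]⟩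

theorem Word.coe_add (hM : IsDilation M) (hD : IsDigitSet M D) (h g : Word D n) :
    (Word.add hM hD h g : ℤ → Fin d → ℤ) = seqAdd M D h g := rfl

theorem Word.add_bijective (hM : IsDilation M) (hD : IsDigitSet M D) (g : Word D n) :
    Function.Bijective fun h => Word.add hM hD h g := by
  constructor
  · intro h h' hh
    refine Word.ext fun j => hD.digitAdd_left_injective hM (h.mem j) (h'.mem j) (t := g j) ?_
    exact congrFun (congrArg (fun w : Word D n => (w : ℤ → Fin d → ℤ)) hh) j
  · intro r
    choose s hs hsr using fun j => hD.exists_digitAdd_eq hM (r.mem j) (g j)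
    -- Where g vanishes the preimage agrees with r, so it has finite support and no digits beyond n.
    have hz : ∀ j, g j = 0 → s j = r j := by
      intro j hj
      rw [← hsr j, hj, hD.digitAdd_zero hM (hs j)]
    refine ⟨⟨Finsupp.ofSupportFinite s ((r.finite.union g.finite).subset fun j hj => ?_), hs, ?_⟩,
      Word.ext hsr⟩
    · by_contra hc
      simp only [Set.mem_union, Set.mem_ofPred_eq, not_or, not_not] at hc
      exact hj (by rw [hz j hc.2, hc.1])
    · intro j hj
      change s j = 0
      rw [hz j (g.apply_of_lt hj), r.apply_of_lt hj]

/-- The translation `x ↦ x ⊕ g` by a sequence of digits. -/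
def shift (M : Matrix (Fin d) (Fin d) ℤ) (D : Finset (Fin d → ℤ)) (g : ℤ → Fin d → ℤ)
    (x : Fin d → ℝ) : Fin d → ℝ :=
  series M (seqAdd M D (digits M D x) g)

theorem isExpansion_shift (hM : IsDilation M) (hD : IsDigitSet M D) (g : Word D n)
    (hx : x ∈ XPlus M D) : IsExpansion M D (shift M D g x) (seqAdd M D (digits M D x) g) := by
  have hx' := digits_spec hx
  refine hM.isExpansion_series (fun j => (hD.digitAdd_spec hM _ _).1)
    ((hx'.left_finite.union g.finite).subset ?_)
  rintro j ⟨hj, hj'⟩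
  by_cases hg : g j = 0
  · rw [seqAdd_apply_of_eq_zero hM hD (hx'.mem j) hg] at hj'
    exact Or.inl ⟨hj, hj'⟩
  · exact Or.inr hg

/-- The digits beyond n are untouched and those up to n are prescribed by h, so the displacement is
constant on the cell. -/
theorem shift_eq_add (hM : IsDilation M) (hD : IsDigitSet M D) (h g : Word D n)
    (hx : x ∈ XPlus M D) (hxh : ∀ j ≤ n, digits M D x j = h j) :
    shift M D g x = x + (series M (Word.add hM hD h g) - series M h) := by
  have hx' := digits_spec hx
  have hhead : head n (digits M D x) = h := by
    ext j : 1
    unfold head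
    split_ifs with hj
    · exact hxh j hj
    · exact (h.apply_of_lt (not_le.1 hj)).symm
  have h1 := hx'.rest_spec hM hD n
  rw [hhead] at h1
  have h2 := ((Word.add hM hD h g).isExpansion hM).add_of_disjoint h1 fun j => by
    rcases le_or_gt j n with hj | hj
    · exact Or.inr (if_pos hj)
    · exact Or.inl ((Word.add hM hD h g).apply_of_lt hj)
  have h3 : (Word.add hM hD h g : ℤ → Fin d → ℤ) + rest n (digits M D x) =
      seqAdd M D (digits M D x) g := by
    ext j : 1
    rw [Word.coe_add, Pi.add_apply]
    rcases le_or_gt j n with hj | hj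
    · simp [rest, hj, seqAdd, hxh j hj]
    · rw [seqAdd_apply_of_eq_zero hM hD (hx'.mem j) (g.apply_of_lt hj),
        seqAdd_apply_of_eq_zero hM hD (h.mem j) (g.apply_of_lt hj), h.apply_of_lt hj]
      simp [rest, not_le.2 hj]
  rw [h3] at h2
  rw [shift, h2.series_eq]
  abel

theorem shift_ae_eq_add (hM : IsDilation M) (hD : IsDigitSet M D) (h g : Word D n) :
    (fun x => x + (series M (Word.add hM hD h g) - series M h))
      =ᵐ[volume.restrict (cell M D n h)] shift M D g := by
  filter_upwards [ae_restrict_cell hM hD h] with x hx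
  exact (shift_eq_add hM hD h g hx.1 hx.2.2).symm

theorem aemeasurable_shift (hM : IsDilation M) (hD : IsDigitSet M D) (g : Word D n) :
    AEMeasurable (shift M D g) (volume.restrict (X M D)) := by
  rw [restrict_X_eq_sum hM hD n]
  exact AEMeasurable.sum_measure fun h =>
    (measurable_id.add_const _).aemeasurable.congr (shift_ae_eq_add hM hD h g)

theorem map_shift_cell (hM : IsDilation M) (hD : IsDigitSet M D) (h g : Word D n) :
    (volume.restrict (cell M D n h)).map (shift M D g) =
      volume.restrict (cell M D n (Word.add hM hD h g)) := by
  rw [← Measure.map_congr (shift_ae_eq_add hM hD h g)]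
  have h1 := (measurePreserving_add_right volume
    (series M (Word.add hM hD h g) - series M h)).restrict_preimage
    (measurableSet_cell hM hD n (Word.add hM hD h g))
  refine Eq.trans ?_ h1.map_eq
  congr 2
  ext x
  simp only [cell, Set.mem_preimage, Set.mem_ofPred_eq]
  congr! 1
  abel

/-- Translation by finitely many digits preserves the measure on `X`. -/
theorem map_shift (hM : IsDilation M) (hD : IsDigitSet M D) (g : Word D n) :
    (volume.restrict (X M D)).map (shift M D g) = volume.restrict (X M D) := by
  have haem := aemeasurable_shift hM hD g
  rw [restrict_X_eq_sum hM hD n] at haem ⊢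
  rw [Measure.map_sum haem]
  simp_rw [map_shift_cell hM hD]
  ext s hs
  rw [Measure.sum_apply _ hs, Measure.sum_apply _ hs]
  -- The shift only permutes the cells, so the sum over words is reindexed.
  exact (Equiv.ofBijective _ (Word.add_bijective hM hD g)).tsum_eq
    fun h : Word D n => (volume.restrict (cell M D n h)) s

theorem ae_shift (hM : IsDilation M) (hD : IsDigitSet M D) (g : Word D n) {p : (Fin d → ℝ) → Prop}
    (hp : ∀ᵐ x ∂volume.restrict (X M D), p x) :
    ∀ᵐ x ∂volume.restrict (X M D), p (shift M D g x) := by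
  rw [← map_shift hM hD g] at hp
  exact ae_of_ae_map (aemeasurable_shift hM hD g) hp

/-- The termwise sum is an expansion of the shifted vector, and by measure preservation almost every
shifted vector avoids `XTilde`, where that expansion is the only one. -/
theorem ae_digits_shift (hM : IsDilation M) (hD : IsDigitSet M D) (g : Word D n) :
    ∀ᵐ x ∂volume.restrict (X M D),
      digits M D (shift M D g x) = seqAdd M D (digits M D x) g := by
  filter_upwards [ae_restrict_X hM hD, ae_shift hM hD g (ae_restrict_X hM hD)] with x hx hx'
  exact (isExpansion_shift hM hD g hx.1).eq_digits hM hD hx'.2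

/-- The word of the digits of an element of `H`. -/
theorem exists_word_of_mem_H (hx : x ∈ H M D) :
    ∃ g : Word D 0, (g : ℤ → Fin d → ℤ) = digits M D x := by
  have hx' := digits_spec (X_subset_XPlus hx.1)
  refine ⟨⟨Finsupp.ofSupportFinite (digits M D x) ((hx'.finite_lt 1).subset fun j hj => ?_),
    hx'.mem, hx.2⟩, rfl⟩
  by_contra hc
  refine hj (hx.2 j ?_)
  by_contra h
  exact hc ⟨by omega, hj⟩

end

/-! ### Characters and the shift formula for integrals -/

section

variable {M : Matrix (Fin d) (Fin d) ℤ} {D : Finset (Fin d → ℤ)} {x y : Fin d → ℝ}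
  {a a' b b' : ℤ → Fin d → ℤ} {n : ℤ}

/-- The pairing `⟨M⁻¹ s, r⟩` of two digits. -/
def pairing (M : Matrix (Fin d) (Fin d) ℤ) (s r : Fin d → ℤ) : ℝ :=
  act M (-1) (toReal s) ⬝ᵥ toReal r

@[simp] theorem pairing_zero_left (r : Fin d → ℤ) : pairing M 0 r = 0 := by simp [pairing]

@[simp] theorem pairing_zero_right (s : Fin d → ℤ) : pairing M s 0 = 0 := by simp [pairing]

theorem pairing_add_left (s t r : Fin d → ℤ) :
    pairing M (s + t) r = pairing M s r + pairing M t r := by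
  rw [pairing, toReal_add, act_add, add_dotProduct, pairing, pairing]

theorem pairing_sub_left (s t r : Fin d → ℤ) :
    pairing M (s - t) r = pairing M s r - pairing M t r := by
  rw [pairing, toReal_sub, act_sub, sub_dotProduct, pairing, pairing]

theorem pairing_sub_right (s r t : Fin d → ℤ) :
    pairing M s (r - t) = pairing M s r - pairing M s t := by
  rw [pairing, toReal_sub, dotProduct_sub, pairing, pairing]

theorem pairing_mulVec (hM : IsDilation M) (s r : Fin d → ℤ) :
    pairing M (M *ᵥ s) r = ((s ⬝ᵥ r : ℤ) : ℝ) := by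
  rw [pairing, toReal_mulVec, hM.act_act, neg_add_cancel, act_zero_left]
  simp [toReal, dotProduct]

theorem exp_two_pi_I_congr {t t' : ℝ} {k : ℤ} (h : t - t' = k) :
    Complex.exp (2 * Real.pi * Complex.I * (t : ℂ)) =
      Complex.exp (2 * Real.pi * Complex.I * (t' : ℂ)) := by
  rw [Complex.exp_eq_exp_iff_exists_int]
  refine ⟨k, ?_⟩
  rw [show t = t' + k by linarith]
  push_cast
  ring

/-- The value of the character `χ` on sequences of digits. -/
def chiSeq (M : Matrix (Fin d) (Fin d) ℤ) (a b : ℤ → Fin d → ℤ) : ℂ :=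
  Complex.exp (2 * Real.pi * Complex.I * ((∑' j : ℤ, pairing M (a j) (b (1 - j)) : ℝ) : ℂ))

theorem norm_chiSeq (a b : ℤ → Fin d → ℤ) : ‖chiSeq M a b‖ = 1 := by
  rw [chiSeq, mul_right_comm, ← Complex.norm_exp_ofReal_mul_I
    (2 * Real.pi * ∑' j : ℤ, pairing M (a j) (b (1 - j)))]
  push_cast
  rfl

theorem chiSeq_mul_conj (a b : ℤ → Fin d → ℤ) :
    chiSeq M a b * (starRingEnd ℂ) (chiSeq M a b) = 1 := by
  rw [Complex.mul_conj, Complex.normSq_eq_norm_sq, norm_chiSeq]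
  simp

/-- The digit of index j meets the digit of index 1 - j, so indices j > n meet only indices at most
-n, where b vanishes. -/
theorem chiSeq_congr_left (h : ∀ j ≤ n, a j = a' j) (hb : ∀ j ≤ -n, b j = 0) :
    chiSeq M a b = chiSeq M a' b := by
  rw [chiSeq, chiSeq]
  congr! 4 with j
  ext j
  rcases le_or_gt j n with hj | hj
  · rw [h j hj]
  · rw [hb (1 - j) (by omega)]; simp

theorem chiSeq_congr_right (h : ∀ j ≤ n, b j = b' j) (ha : ∀ j ≤ -n, a j = 0) :
    chiSeq M a b = chiSeq M a b' := by
  rw [chiSeq, chiSeq]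
  congr! 4 with j
  ext j
  rcases le_or_gt (1 - j) n with hj | hj
  · rw [h _ hj]
  · rw [ha j (by omega)]; simp

theorem chiSeq_eq_prod {F : Finset ℤ} (hF : ∀ j ∉ F, pairing M (a j) (b (1 - j)) = 0) :
    chiSeq M a b = ∏ j ∈ F,
      Complex.exp (2 * Real.pi * Complex.I * (pairing M (a j) (b (1 - j)) : ℂ)) := by
  rw [chiSeq, tsum_eq_sum hF, ← Complex.exp_sum, ← Finset.mul_sum]
  push_cast
  rfl

theorem chiSeq_seqAdd (hM : IsDilation M) (hD : IsDigitSet M D) {N N' : ℤ}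
    (ha : ∀ j, a j ∈ D) (ha0 : ∀ j ≤ N, a j = 0) (g : Word D n) (hb : ∀ j ≤ N', b j = 0) :
    chiSeq M (seqAdd M D a g) b = chiSeq M a b * chiSeq M g b := by
  obtain ⟨N₁, hN₁⟩ := (g.isExpansion hM).exists_lower_bound
  -- Below this range both a and g vanish; above it the digits of b with index 1 - j vanish.
  set F := Finset.Icc (min N N₁) (1 - N')
  have hnot : ∀ j ∉ F, j < min N N₁ ∨ 1 - j ≤ N' := by
    intro j hj
    rw [Finset.mem_Icc] at hj
    omega
  rw [chiSeq_eq_prod (F := F), chiSeq_eq_prod (F := F), chiSeq_eq_prod (F := F),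
    ← Finset.prod_mul_distrib]
  · refine Finset.prod_congr rfl fun j _ => ?_
    rw [← Complex.exp_add, ← mul_add, ← Complex.ofReal_add, ← pairing_add_left]
    -- Reducing the sum of two digits changes it by M s, hence the pairing by an integer, invisible
    -- to the exponential.
    obtain ⟨s, hs⟩ := (hD.digitAdd_spec hM (a j) (g j)).2
    refine (exp_two_pi_I_congr (k := s ⬝ᵥ b (1 - j)) ?_).symm
    rw [← pairing_mulVec hM, ← hs, pairing_sub_left]
    rfl
  · intro j hj
    rcases hnot j hj with h | h
    · rw [hN₁ j (by omega), pairing_zero_left]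
    · rw [hb _ h, pairing_zero_right]
  · intro j hj
    rcases hnot j hj with h | h
    · rw [ha0 j (by omega), pairing_zero_left]
    · rw [hb _ h, pairing_zero_right]
  · intro j hj
    rcases hnot j hj with h | h
    · rw [seqAdd_apply_of_eq_zero hM hD (ha j) (hN₁ j (by omega)), ha0 j (by omega),
        pairing_zero_left]
    · rw [hb _ h, pairing_zero_right]

/-- A function depending only on the digits with index at most `n` is measurable. -/
theorem aestronglyMeasurable_of_digits (hM : IsDilation M) (hD : IsDigitSet M D) (n : ℤ)
    {φ : (Fin d → ℝ) → ℂ} {Φ : (ℤ → Fin d → ℤ) → ℂ} (hφ : ∀ x, φ x = Φ (digits M D x))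
    (hΦ : ∀ a a', (∀ j ≤ n, a j = a' j) → Φ a = Φ a') :
    AEStronglyMeasurable φ (volume.restrict (X M D)) := by
  rw [restrict_X_eq_sum hM hD n]
  refine AEStronglyMeasurable.sum_measure fun h => ?_
  refine (aestronglyMeasurable_const (b := Φ h)).congr ?_
  filter_upwards [ae_restrict_cell hM hD h] with x hx
  rw [hφ]
  exact (hΦ _ _ hx.2.2).symm

theorem aestronglyMeasurable_chiSeq_left (hM : IsDilation M) (hD : IsDigitSet M D)
    {N : ℤ} (hb : ∀ j ≤ N, b j = 0) :
    AEStronglyMeasurable (fun x => chiSeq M (digits M D x) b) (volume.restrict (X M D)) :=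
  aestronglyMeasurable_of_digits hM hD (-N) (fun _ => rfl)
    fun _ _ h => chiSeq_congr_left h (by simpa using hb)

theorem aestronglyMeasurable_chiSeq_right {M' : Matrix (Fin d) (Fin d) ℤ}
    {D' : Finset (Fin d → ℤ)} (hM' : IsDilation M') (hD' : IsDigitSet M' D')
    {N : ℤ} (ha : ∀ j ≤ N, a j = 0) :
    AEStronglyMeasurable (fun ω => chiSeq M a (digits M' D' ω)) (volume.restrict (X M' D')) :=
  aestronglyMeasurable_of_digits hM' hD' (-N) (fun _ => rfl)
    fun _ _ h => chiSeq_congr_right h (by simpa using ha)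

/-- The integral of `f` against the conjugate of the character with the digits `b`. -/
def coeff (M : Matrix (Fin d) (Fin d) ℤ) (D : Finset (Fin d → ℤ)) (f : (Fin d → ℝ) → ℂ)
    (b : ℤ → Fin d → ℤ) : ℂ :=
  ∫ x in X M D, f x * (starRingEnd ℂ) (chiSeq M (digits M D x) b)

theorem fourierL1_eq_coeff {D' : Finset (Fin d → ℤ)} (f : (Fin d → ℝ) → ℂ) (ω : Fin d → ℝ) :
    fourierL1 M D D' f ω =
      (1 / ((volume.real (U M D) : ℝ) : ℂ)) * coeff M D f (digits Mᵀ D' ω) := rfl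

theorem ae_chiSeq_shift (hM : IsDilation M) (hD : IsDigitSet M D) (g : Word D n) {N : ℤ}
    (hb : ∀ j ≤ N, b j = 0) : ∀ᵐ x ∂volume.restrict (X M D),
      chiSeq M (digits M D (shift M D g x)) b = chiSeq M (digits M D x) b * chiSeq M g b := by
  filter_upwards [ae_restrict_X hM hD, ae_digits_shift hM hD g] with x hx hxs
  have hx' := digits_spec hx.1
  obtain ⟨N', hN'⟩ := hx'.exists_lower_bound
  rw [hxs, chiSeq_seqAdd hM hD hx'.mem hN' g hb]

theorem memLp_comp_shift (hM : IsDilation M) (hD : IsDigitSet M D) (g : Word D n) {p : ENNReal}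
    {f : (Fin d → ℝ) → ℂ} (hf : MemLp f p (volume.restrict (X M D))) :
    MemLp (fun x => f (shift M D g x)) p (volume.restrict (X M D)) := by
  rw [← map_shift hM hD g] at hf
  exact (memLp_map_measure_iff hf.1 (aemeasurable_shift hM hD g)).1 hf

/-- Measure preservation replaces the shifted vector by x; the factor χ(g, b) appears because the
conjugate character at the shifted vector carries its conjugate, and χ(g, b) has modulus 1. -/
theorem coeff_comp_shift (hM : IsDilation M) (hD : IsDigitSet M D) (g : Word D n) {N : ℤ}
    (hb : ∀ j ≤ N, b j = 0) {f : (Fin d → ℝ) → ℂ}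
    (hf : AEStronglyMeasurable f (volume.restrict (X M D))) :
    coeff M D (fun x => f (shift M D g x)) b = coeff M D f b * chiSeq M g b := by
  set F : (Fin d → ℝ) → ℂ := fun x => f x * (starRingEnd ℂ) (chiSeq M (digits M D x) b) with hF
  have hFm : AEStronglyMeasurable F (volume.restrict (X M D)) :=
    hf.mul (Complex.continuous_conj.comp_aestronglyMeasurable
      (aestronglyMeasurable_chiSeq_left hM hD hb))
  have h1 : ∫ x in X M D, F (shift M D g x) = ∫ x in X M D, F x := by
    rw [← integral_map (aemeasurable_shift hM hD g) (by rwa [map_shift hM hD g]),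
      map_shift hM hD g]
  calc coeff M D (fun x => f (shift M D g x)) b
      = ∫ x in X M D, F (shift M D g x) * chiSeq M g b := by
        refine integral_congr_ae ?_
        filter_upwards [ae_chiSeq_shift hM hD g hb] with x hx
        have h2 := chiSeq_mul_conj (M := M) g b
        simp only [hF, hx, map_mul]
        linear_combination
          -(f (shift M D g x) * (starRingEnd ℂ) (chiSeq M (digits M D x) b)) * h2
    _ = coeff M D f b * chiSeq M g b := by
        rw [integral_mul_const, h1]
        rfl

end

/-! ### Orthogonality of characters and the uniform L² bound -/

section

variable {M : Matrix (Fin d) (Fin d) ℤ} {D D' : Finset (Fin d → ℤ)} {x y : Fin d → ℝ}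
  {a a' b b' : ℤ → Fin d → ℤ} {n l : ℤ}

theorem toReal_injective : Function.Injective (toReal : (Fin d → ℤ) → Fin d → ℝ) := by
  intro s t h
  ext i
  have := congrFun h i
  simpa [toReal] using this

theorem act_dotProduct (M : Matrix (Fin d) (Fin d) ℤ) (n : ℤ) (x y : Fin d → ℝ) :
    act M n x ⬝ᵥ y = x ⬝ᵥ act Mᵀ n y := by
  rw [act, act, Matrix.dotProduct_mulVec, ← Matrix.mulVec_transpose, Matrix.transpose_zpow,
    Matrix.transpose_map, Matrix.transpose_transpose]

/-- The digits of `D` separate the digits of `D'`. -/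
theorem exists_exp_pairing_ne (hM : IsDilation M) (hD : IsDigitSet M D) (hD' : IsDigitSet Mᵀ D')
    {r r' : Fin d → ℤ} (hr : r ∈ D') (hr' : r' ∈ D') (hne : r ≠ r') :
    ∃ s ∈ D, Complex.exp (2 * Real.pi * Complex.I * (pairing M s r : ℂ)) ≠
      Complex.exp (2 * Real.pi * Complex.I * (pairing M s r' : ℂ)) := by
  by_contra! hall
  refine hne (hD'.eq_of_congr r hr r' hr' ?_)
  -- Every integer vector is congruent to a digit, so integrality extends from D to all v. Taking
  -- unit vectors for v shows that the inverse transpose of M maps r - r' to an integer vector.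
  have hint : ∀ v : Fin d → ℤ, ∃ k : ℤ, pairing M v (r - r') = k := by
    intro v
    obtain ⟨s, hs, w, hw⟩ := hD.exists_congr hM v
    obtain ⟨k, hk⟩ := Complex.exp_eq_exp_iff_exists_int.1 (hall s hs)
    have h2 : (2 * Real.pi * Complex.I : ℂ) ≠ 0 := by simp [Real.pi_ne_zero]
    have h3 : (pairing M s r : ℂ) = pairing M s r' + k := by
      refine mul_left_cancel₀ h2 ?_
      rw [hk]; ring
    have h4 : pairing M s r = pairing M s r' + k := by exact_mod_cast h3
    refine ⟨k + w ⬝ᵥ (r - r'), ?_⟩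
    rw [show v = s + M *ᵥ w by rw [← hw]; abel, pairing_add_left, pairing_mulVec hM,
      pairing_sub_right, h4]
    push_cast
    ring
  choose k hk using fun i : Fin d => hint (Pi.single i 1)
  refine ⟨k, toReal_injective ?_⟩
  have h1 : act Mᵀ (-1) (toReal (r - r')) = toReal k := by
    ext i
    have h2 := hk i
    rw [pairing, act_dotProduct] at h2
    have h3 : toReal (Pi.single i 1 : Fin d → ℤ) = Pi.single i (1 : ℝ) := by
      ext j
      by_cases h : j = i
      · subst h; simp [toReal]
      · simp [toReal, h]
    rw [h3, single_one_dotProduct] at h2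
    exact h2
  rw [toReal_mulVec, ← h1, hM.transpose.act_act]
  simp

theorem Word.exists_lower_bound (h : Word D n) : ∃ N : ℤ, ∀ j ≤ N, h j = 0 := by
  obtain ⟨N, hN⟩ := h.finite.bddBelow
  refine ⟨N - 1, fun j hj => ?_⟩
  by_contra hc
  have := hN hc
  omega

theorem mem_tail_iff (hM : IsDilation M) (hD : IsDigitSet M D) (hx : x ∈ XPlus M D)
    (hx' : x ∉ XTilde M D) : x ∈ tail M D n ↔ ∀ j ≤ n, digits M D x j = 0 := by
  constructor
  · rintro ⟨a, ha, h0⟩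
    rwa [ha.eq_digits hM hD hx']
  · exact fun h => ⟨_, digits_spec hx, h⟩

theorem tail_subset_XPlus : tail M D n ⊆ XPlus M D := fun _ ⟨a, ha, _⟩ => ⟨a, ha⟩

theorem ae_mem_tail_shift (hM : IsDilation M) (hD : IsDigitSet M D) {k : ℤ} (g : Word D n)
    (hg : ∀ j ≤ k, g j = 0) : ∀ᵐ x ∂volume.restrict (X M D),
      (shift M D g x ∈ tail M D k ↔ x ∈ tail M D k) := by
  filter_upwards [ae_restrict_X hM hD, ae_digits_shift hM hD g,
    ae_shift hM hD g (ae_restrict_X hM hD)] with x hx hxs hx'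
  rw [mem_tail_iff hM hD hx'.1 hx'.2, mem_tail_iff hM hD hx.1 hx.2, hxs]
  refine forall₂_congr fun j hj => ?_
  rw [seqAdd_apply_of_eq_zero hM hD ((digits_spec hx.1).mem j) (hg j hj)]

theorem indicator_tail_comp_shift (hM : IsDilation M) (hD : IsDigitSet M D) {k : ℤ} (g : Word D n)
    (hg : ∀ j ≤ k, g j = 0) (f : (Fin d → ℝ) → ℂ) :
    (fun x => (tail M D k).indicator f (shift M D g x)) =ᵐ[volume.restrict (X M D)]
      (tail M D k).indicator fun x => f (shift M D g x) := by
  filter_upwards [ae_mem_tail_shift hM hD g hg] with x hx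
  by_cases h : x ∈ tail M D k
  · rw [Set.indicator_of_mem h, Set.indicator_of_mem (hx.2 h)]
  · rw [Set.indicator_of_notMem h, Set.indicator_of_notMem (hx.not.2 h)]

theorem coeff_congr {f f' : (Fin d → ℝ) → ℂ} (h : f =ᵐ[volume.restrict (X M D)] f')
    (b : ℤ → Fin d → ℤ) : coeff M D f b = coeff M D f' b := by
  refine integral_congr_ae ?_
  filter_upwards [h] with x hx
  rw [hx]

/-- The character with the digits `b`, cut off outside `M ^ (-n) (tail 0)`. -/
def cutChar (M : Matrix (Fin d) (Fin d) ℤ) (D : Finset (Fin d → ℤ)) (n : ℤ)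
    (b : ℤ → Fin d → ℤ) : (Fin d → ℝ) → ℂ :=
  (tail M D n).indicator fun x => chiSeq M (digits M D x) b

theorem measurableSet_tail (hM : IsDilation M) (hD : IsDigitSet M D) (n : ℤ) :
    MeasurableSet (tail M D n) := (isCompact_tail hM hD n).measurableSet

theorem aestronglyMeasurable_cutChar (hM : IsDilation M) (hD : IsDigitSet M D) {N : ℤ}
    (hb : ∀ j ≤ N, b j = 0) :
    AEStronglyMeasurable (cutChar M D n b) (volume.restrict (X M D)) :=
  (aestronglyMeasurable_chiSeq_left hM hD hb).indicator (measurableSet_tail hM hD n)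

theorem volume_restrict_X_tail (hM : IsDilation M) (hD : IsDigitSet M D) (n : ℤ) :
    volume.restrict (X M D) (tail M D n) = volume (tail M D n) := by
  rw [Measure.restrict_congr_set (X_ae_eq_XPlus hM hD),
    Measure.restrict_apply (measurableSet_tail hM hD n),
    Set.inter_eq_left.2 tail_subset_XPlus]

theorem memLp_cutChar (hM : IsDilation M) (hD : IsDigitSet M D) {N : ℤ}
    (hb : ∀ j ≤ N, b j = 0) (p : ENNReal) :
    MemLp (cutChar M D n b) p (volume.restrict (X M D)) := by
  have h : MemLp ((tail M D n).indicator fun _ => (1 : ℂ)) p (volume.restrict (X M D)) := by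
    refine memLp_indicator_const p (measurableSet_tail hM hD n) _ (Or.inr ?_)
    rw [volume_restrict_X_tail hM hD]
    exact (isCompact_tail hM hD n).measure_ne_top
  refine h.mono (aestronglyMeasurable_cutChar hM hD hb) (ae_of_all _ fun x => ?_)
  by_cases hx : x ∈ tail M D n
  · simp [cutChar, hx, norm_chiSeq]
  · simp [cutChar, hx]

theorem coeff_cutChar_self (hM : IsDilation M) (hD : IsDigitSet M D) (b : ℤ → Fin d → ℤ) :
    coeff M D (cutChar M D n b) b = volume.real (tail M D n) := by
  have h : ∀ x, cutChar M D n b x * (starRingEnd ℂ) (chiSeq M (digits M D x) b) =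
      (tail M D n).indicator (fun _ => (1 : ℂ)) x := by
    intro x
    by_cases hx : x ∈ tail M D n
    · simp [cutChar, hx, chiSeq_mul_conj]
    · simp [cutChar, hx]
  simp_rw [coeff, h]
  rw [integral_indicator_const _ (measurableSet_tail hM hD n), measureReal_def,
    volume_restrict_X_tail hM hD, measureReal_def]
  simp

/-- The usual orthogonality argument: shifting by a suitable word g multiplies the integral both by
χ(g, h) and by χ(g, h'), which differ. -/
theorem coeff_cutChar_of_ne (hM : IsDilation M) (hD : IsDigitSet M D) (hD' : IsDigitSet Mᵀ D')
    {h h' : Word D' l} (hne : h ≠ h') : coeff M D (cutChar M D (-l) h') h = 0 := by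
  obtain ⟨i, hi⟩ : ∃ i, h i ≠ h' i := by
    by_contra! hc
    exact hne (Word.ext hc)
  have hil : i ≤ l := by
    by_contra hc
    exact hi (by rw [h.apply_of_lt (not_le.1 hc), h'.apply_of_lt (not_le.1 hc)])
  obtain ⟨N, hN⟩ := h.exists_lower_bound
  obtain ⟨N', hN'⟩ := h'.exists_lower_bound
  obtain ⟨s, hs, hsne⟩ := exists_exp_pairing_ne hM hD hD' (h.mem i) (h'.mem i) hi
  -- Index 1 - i is the one paired with index i. As i ≤ l, it exceeds -l, so the shift by g
  -- preserves the cut-off set.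
  let g : Word D (1 - i) := ⟨Finsupp.single (1 - i) s, fun j => by
    rw [Finsupp.single_apply]
    split_ifs
    exacts [hs, hD.zero_mem], fun j hj => by rw [Finsupp.single_apply, if_neg (by omega)]⟩
  have hg : ∀ j, j ≠ 1 - i → g j = 0 := fun j hj => Finsupp.single_eq_of_ne hj
  have hgi : g (1 - i) = s := Finsupp.single_eq_same
  have hchi : ∀ b : ℤ → Fin d → ℤ, chiSeq M g b =
      Complex.exp (2 * Real.pi * Complex.I * (pairing M s (b i) : ℂ)) := by
    intro b
    rw [chiSeq_eq_prod (F := {1 - i}), Finset.prod_singleton, hgi, sub_sub_cancel]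
    intro j hj
    rw [hg j (by simpa using hj), pairing_zero_left]
  have h1 := coeff_comp_shift hM hD g hN (aestronglyMeasurable_cutChar (n := -l) hM hD hN')
  have h2 : coeff M D (fun x => cutChar M D (-l) h' (shift M D g x)) h =
      chiSeq M g h' * coeff M D (cutChar M D (-l) h') h := by
    rw [coeff, coeff, ← integral_const_mul]
    refine integral_congr_ae ?_
    filter_upwards [indicator_tail_comp_shift hM hD (k := -l) g (fun j hj => hg j (by omega))
      (fun x => chiSeq M (digits M D x) h'), ae_chiSeq_shift hM hD g hN'] with x hx hx'
    rw [cutChar, hx]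
    by_cases hxt : x ∈ tail M D (-l)
    · simp only [Set.indicator_of_mem hxt, hx']
      ring
    · simp [hxt]
  rw [h2, mul_comm] at h1
  rw [← hchi, ← hchi] at hsne
  have h3 : coeff M D (cutChar M D (-l) h') h * (chiSeq M g h' - chiSeq M g h) = 0 := by
    rw [mul_sub, h1, sub_self]
  exact (mul_eq_zero.1 h3).resolve_right (sub_ne_zero.2 hsne.symm)

/-- Bessel's inequality for the cut-off characters, which are orthogonal with squared norm V. -/
theorem sum_norm_coeff_sq_le (hM : IsDilation M) (hD : IsDigitSet M D) (hD' : IsDigitSet Mᵀ D')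
    {q : (Fin d → ℝ) → ℂ} (hq : MemLp q 2 (volume.restrict (X M D)))
    (hq0 : ∀ x ∉ tail M D (-l), q x = 0) (S : Finset (Word D' l)) :
    ∑ h ∈ S, ‖coeff M D q h‖ ^ 2 ≤ volume.real (tail M D (-l)) *
      (eLpNorm q 2 (volume.restrict (X M D))).toReal ^ 2 := by
  classical
  set V := volume.real (tail M D (-l)) with hV
  -- Normalising divides by √V; if V = 0 then q vanishes almost everywhere and both sides are zero.
  rcases (measureReal_nonneg : 0 ≤ V).eq_or_lt with h0 | hpos
  · have hz : q =ᵐ[volume.restrict (X M D)] fun _ => 0 := by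
      have h1 : volume.restrict (X M D) (tail M D (-l)) = 0 := by
        rw [volume_restrict_X_tail hM hD]
        exact (measureReal_eq_zero_iff (isCompact_tail hM hD _).measure_ne_top).1 h0.symm
      filter_upwards [compl_mem_ae_iff.2 h1] with x hx
      exact hq0 x hx
    have h2 : ∀ b, coeff M D q b = 0 := by
      intro b
      rw [coeff_congr hz]
      simp [coeff]
    have hV0 : 0 ≤ V := measureReal_nonneg
    simp only [h2, norm_zero, ne_eq, OfNat.ofNat_ne_zero, not_false_eq_true, zero_pow,
      Finset.sum_const_zero]
    positivity
  choose N hN using fun h : Word D' l => h.exists_lower_bound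
  let v : Word D' l → Lp ℂ 2 (volume.restrict (X M D)) := fun h =>
    (memLp_cutChar (n := -l) hM hD (hN h) 2).toLp
  have hv : ∀ (h : Word D' l) (p : (Fin d → ℝ) → ℂ) (hp : MemLp p 2 (volume.restrict (X M D))),
      (∀ x ∉ tail M D (-l), p x = 0) → inner ℂ (v h) hp.toLp = coeff M D p h := by
    intro h p hp hp0
    rw [L2.inner_def]
    refine integral_congr_ae ?_
    filter_upwards [MemLp.coeFn_toLp (memLp_cutChar (n := -l) hM hD (hN h) 2),
      MemLp.coeFn_toLp hp] with x hx hx'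
    rw [hx, hx', RCLike.inner_apply]
    by_cases hxt : x ∈ tail M D (-l)
    · rw [cutChar, Set.indicator_of_mem hxt]
    · rw [hp0 x hxt, zero_mul, zero_mul]
  have hvv : ∀ h h', inner ℂ (v h) (v h') = if h = h' then (V : ℂ) else 0 := by
    intro h h'
    rw [hv h _ (memLp_cutChar (n := -l) hM hD (hN h') 2)
      fun x hx => Set.indicator_of_notMem hx _]
    split_ifs with heq
    · subst heq
      exact coeff_cutChar_self hM hD _
    · exact coeff_cutChar_of_ne hM hD hD' heq
  have horth : Orthonormal ℂ fun h => (((√V)⁻¹ : ℝ) : ℂ) • v h := by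
    rw [orthonormal_iff_ite]
    intro h h'
    rw [inner_smul_left, inner_smul_right, hvv, Complex.conj_ofReal]
    split_ifs
    · rw [← mul_assoc, ← Complex.ofReal_mul, ← Complex.ofReal_mul, ← mul_inv,
        Real.mul_self_sqrt hpos.le, inv_mul_cancel₀ hpos.ne', Complex.ofReal_one]
    · simp
  have hB := horth.sum_inner_products_le (hq.toLp) (s := S)
  rw [Lp.norm_toLp] at hB
  refine le_trans (le_of_eq ?_) (mul_le_mul_of_nonneg_left hB hpos.le)
  rw [Finset.mul_sum]
  refine Finset.sum_congr rfl fun h _ => ?_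
  rw [inner_smul_left, hv h q hq hq0, norm_mul, mul_pow, Complex.conj_ofReal, Complex.norm_real,
    norm_inv, inv_pow, Real.norm_of_nonneg (Real.sqrt_nonneg _), Real.sq_sqrt hpos.le,
    mul_inv_cancel_left₀ hpos.ne']

/-- On the support of q the digits of index at most -l are almost everywhere zero, so digits of b
beyond l are never paired with anything. Hence the transform of q is almost everywhere constant on
each level l cell of the dual space. -/
theorem coeff_congr_right {q : (Fin d → ℝ) → ℂ} (hM : IsDilation M) (hD : IsDigitSet M D)
    (hq0 : ∀ x ∉ tail M D (-l), q x = 0) (hb : ∀ j ≤ l, b j = b' j) :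
    coeff M D q b = coeff M D q b' := by
  refine integral_congr_ae ?_
  filter_upwards [ae_restrict_X hM hD] with x hx
  by_cases hxt : x ∈ tail M D (-l)
  · rw [chiSeq_congr_right hb ((mem_tail_iff hM hD hx.1 hx.2).1 hxt)]
  · rw [hq0 x hxt, zero_mul, zero_mul]

theorem tsum_enorm_coeff_sq_le (hM : IsDilation M) (hD : IsDigitSet M D) (hD' : IsDigitSet Mᵀ D')
    {q : (Fin d → ℝ) → ℂ} (hq : MemLp q 2 (volume.restrict (X M D)))
    (hq0 : ∀ x ∉ tail M D (-l), q x = 0) :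
    ∑' h : Word D' l, ‖coeff M D q h‖ₑ ^ 2 ≤ volume (tail M D (-l)) *
      eLpNorm q 2 (volume.restrict (X M D)) ^ 2 := by
  rw [ENNReal.tsum_eq_iSup_sum]
  refine iSup_le fun S => ?_
  have h := ENNReal.ofReal_le_ofReal (sum_norm_coeff_sq_le hM hD hD' hq hq0 S)
  rw [ENNReal.ofReal_mul measureReal_nonneg, measureReal_def,
    ENNReal.ofReal_toReal (isCompact_tail hM hD _).measure_ne_top,
    ENNReal.ofReal_pow ENNReal.toReal_nonneg, ENNReal.ofReal_toReal hq.2.ne,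
    ENNReal.ofReal_sum_of_nonneg fun _ _ => by positivity] at h
  refine le_trans (le_of_eq (Finset.sum_congr rfl fun w _ => ?_)) h
  rw [ENNReal.ofReal_pow (norm_nonneg _), ofReal_norm]

/-- Raising l by one multiplies the first volume by m and divides the second by the same m; this
makes the L² bound independent of l. -/
theorem volume_tail_mul_volume_tail (hM : IsDilation M) (hD : IsDigitSet M D)
    (hD' : IsDigitSet Mᵀ D') (l : ℕ) :
    volume (tail M D (-l)) * volume (tail Mᵀ D' l) =
      volume (tail M D 0) * volume (tail Mᵀ D' 0) := by
  induction l with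
  | zero => simp
  | succ l ih =>
    have hcard : D.card = D'.card := by
      rw [hD.card_eq, hD'.card_eq, Matrix.det_transpose]
    rw [← ih, hM.volume_image_act hD (tail M D (-((l + 1 : ℕ) : ℤ))),
      hM.transpose.volume_image_act hD' (tail Mᵀ D' (l : ℤ)), image_act_tail hM,
      image_act_tail hM.transpose, hcard]
    rw [show -((l + 1 : ℕ) : ℤ) - -1 = -(l : ℤ) by push_cast; ring,
      show (l : ℤ) - -1 = ((l + 1 : ℕ) : ℤ) by push_cast; ring]
    ring

theorem eLpNorm_two_sq {α E : Type*} [MeasurableSpace α] {μ : Measure α} [NormedAddCommGroup E]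
    (f : α → E) : eLpNorm f 2 μ ^ 2 = ∫⁻ x, ‖f x‖ₑ ^ 2 ∂μ := by
  simpa using eLpNorm_nnreal_pow_eq_lintegral (μ := μ) (f := f) (p := 2) (by norm_num)

theorem aestronglyMeasurable_fourierL1 (hM : IsDilation M) (hD : IsDigitSet M D)
    (hD' : IsDigitSet Mᵀ D') {q : (Fin d → ℝ) → ℂ} (hq0 : ∀ x ∉ tail M D (-l), q x = 0) :
    AEStronglyMeasurable (fourierL1 M D D' q) (volume.restrict (X Mᵀ D')) :=
  aestronglyMeasurable_of_digits hM.transpose hD' l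
    (Φ := fun b => (1 / ((volume.real (U M D) : ℝ) : ℂ)) * coeff M D q b) (fun _ => rfl)
    fun _ _ h => by rw [coeff_congr_right hM hD hq0 h]

/-- The bound for the Fourier transform in `L²`, with a constant that does not depend on the
support. -/
theorem exists_eLpNorm_fourierL1_le (hM : IsDilation M) (hD : IsDigitSet M D)
    (hD' : IsDigitSet Mᵀ D') : ∃ C : ENNReal, C ≠ ⊤ ∧ ∀ (l : ℕ) (q : (Fin d → ℝ) → ℂ),
      MemLp q 2 (volume.restrict (X M D)) → (∀ x ∉ tail M D (-l), q x = 0) →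
      eLpNorm (fourierL1 M D D' q) 2 (volume.restrict (X Mᵀ D')) ≤
        C * eLpNorm q 2 (volume.restrict (X M D)) := by
  set c : ℂ := 1 / ((volume.real (U M D) : ℝ) : ℂ) with hc
  set K : ENNReal := volume (tail M D 0) * volume (tail Mᵀ D' 0) with hK
  have hKtop : K ≠ ⊤ := ENNReal.mul_ne_top (isCompact_tail hM hD 0).measure_ne_top
    (isCompact_tail hM.transpose hD' 0).measure_ne_top
  refine ⟨‖c‖ₑ * K ^ (1 / 2 : ℝ), ENNReal.mul_ne_top enorm_ne_top
    (ENNReal.rpow_ne_top_of_nonneg (by norm_num) hKtop), fun l q hq hq0 => ?_⟩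
  have hK2 : (K ^ (1 / 2 : ℝ)) ^ 2 = K := by
    rw [← ENNReal.rpow_natCast, ← ENNReal.rpow_mul]
    norm_num
  refine (ENNReal.pow_le_pow_left_iff two_ne_zero).1 ?_
  rw [eLpNorm_two_sq, mul_pow, mul_pow, hK2,
    restrict_X_eq_sum hM.transpose hD' l, lintegral_sum_measure]
  have hcell : ∀ h : Word D' l, ∫⁻ ω in cell Mᵀ D' l h, ‖fourierL1 M D D' q ω‖ₑ ^ 2 =
      ‖c‖ₑ ^ 2 * volume (tail Mᵀ D' l) * ‖coeff M D q h‖ₑ ^ 2 := by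
    intro h
    have h1 : ∀ᵐ ω ∂volume.restrict (cell Mᵀ D' l h),
        ‖fourierL1 M D D' q ω‖ₑ ^ 2 = ‖c‖ₑ ^ 2 * ‖coeff M D q h‖ₑ ^ 2 := by
      filter_upwards [ae_restrict_cell hM.transpose hD' h] with ω hω
      rw [fourierL1_eq_coeff, coeff_congr_right hM hD hq0 hω.2.2, enorm_mul, mul_pow]
    rw [lintegral_congr_ae h1, setLIntegral_const, volume_cell]
    ring
  simp_rw [hcell]
  rw [ENNReal.tsum_mul_left]
  refine (mul_le_mul_right (tsum_enorm_coeff_sq_le hM hD hD' hq hq0) _).trans (le_of_eq ?_)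
  rw [hK, ← volume_tail_mul_volume_tail hM hD hD' l]
  ring

end

/-! ### The L² Fourier transform and its shift formula -/

section

variable {M : Matrix (Fin d) (Fin d) ℤ} {D D' : Finset (Fin d → ℤ)} {x : Fin d → ℝ}
  {b : ℤ → Fin d → ℤ} {n : ℤ}

/-- `U` lies in `tail M D 0` and misses only ambiguous vectors, so J_l is the integral transform of
a cut-off function. -/
theorem image_act_U_ae_eq (hM : IsDilation M) (hD : IsDigitSet M D) (n : ℤ) :
    act M n '' U M D =ᵐ[volume] tail M D (-n) := by
  have hnull : volume (act M n '' XTilde M D) = 0 := by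
    refine (Measure.addHaar_image_linearMap (volume : Measure (Fin d → ℝ))
      (Matrix.mulVecLin ((M.map (Int.cast : ℤ → ℝ)) ^ n)) (XTilde M D)).trans ?_
    rw [volume_XTilde hM hD, mul_zero]
  have himg : act M n '' tail M D 0 = tail M D (-n) := by rw [image_act_tail hM, zero_sub]
  have hsub : act M n '' U M D ⊆ act M n '' tail M D 0 :=
    Set.image_mono fun x hx => ⟨_, digits_spec (X_subset_XPlus hx.1), hx.2⟩
  refine Filter.EventuallyLE.antisymm (himg ▸ hsub).eventuallyLE ?_
  · rw [← himg]
    filter_upwards [compl_mem_ae_iff.2 hnull] with x hx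
    rintro ⟨y, hy, rfl⟩
    have hy' : y ∉ XTilde M D := fun h => hx ⟨y, h, rfl⟩
    have hyp := tail_subset_XPlus hy
    exact ⟨y, ⟨Or.inl ⟨hyp, hy'⟩, (mem_tail_iff hM hD hyp hy').1 hy⟩, rfl⟩

theorem truncFourier_eq_fourierL1 (hM : IsDilation M) (hD : IsDigitSet M D) (l : ℕ)
    (f : (Fin d → ℝ) → ℂ) : truncFourier M D D' l f =
      fourierL1 M D D' ((tail M D (-l)).indicator f) := by
  ext ω
  rw [truncFourier, fourierL1, fourierOn, fourierOn]
  congr 1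
  rw [setIntegral_congr_set (image_act_U_ae_eq hM hD l),
    setIntegral_congr_set (X_ae_eq_XPlus hM hD)]
  have hmul : ∀ x, (tail M D (-l)).indicator f x * (starRingEnd ℂ) (chi M D D' x ω) =
      (tail M D (-l)).indicator (fun x => f x * (starRingEnd ℂ) (chi M D D' x ω)) x :=
    fun x => by by_cases hx : x ∈ tail M D (-l) <;> simp [hx]
  simp_rw [hmul]
  rw [integral_indicator (measurableSet_tail hM hD _),
    Measure.restrict_restrict (measurableSet_tail hM hD _),
    Set.inter_eq_left.2 tail_subset_XPlus]

theorem coeff_sub (hM : IsDilation M) (hD : IsDigitSet M D) {N : ℤ} (hb : ∀ j ≤ N, b j = 0)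
    {p q : (Fin d → ℝ) → ℂ} (hp : MemLp p 2 (volume.restrict (X M D)))
    (hq : MemLp q 2 (volume.restrict (X M D))) (hp0 : ∀ x ∉ tail M D n, p x = 0)
    (hq0 : ∀ x ∉ tail M D n, q x = 0) :
    coeff M D (p - q) b = coeff M D p b - coeff M D q b := by
  have hint : ∀ p : (Fin d → ℝ) → ℂ, MemLp p 2 (volume.restrict (X M D)) →
      (∀ x ∉ tail M D n, p x = 0) → Integrable
        (fun x => p x * (starRingEnd ℂ) (chiSeq M (digits M D x) b))
        (volume.restrict (X M D)) := by
    intro p hp hp0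
    refine (hp.integrable_mul (memLp_cutChar (n := n) hM hD hb 2).star).congr
      (ae_of_all _ fun x => ?_)
    by_cases hx : x ∈ tail M D n
    · simp [cutChar, hx]
    · simp [hp0 x hx]
  rw [coeff, coeff, coeff, ← integral_sub (hint p hp hp0) (hint q hq hq0)]
  simp only [Pi.sub_apply, sub_mul]

theorem fourierL1_sub_ae (hM : IsDilation M) (hD : IsDigitSet M D) (hD' : IsDigitSet Mᵀ D')
    {p q : (Fin d → ℝ) → ℂ} (hp : MemLp p 2 (volume.restrict (X M D)))
    (hq : MemLp q 2 (volume.restrict (X M D))) (hp0 : ∀ x ∉ tail M D n, p x = 0)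
    (hq0 : ∀ x ∉ tail M D n, q x = 0) :
    fourierL1 M D D' (p - q) =ᵐ[volume.restrict (X Mᵀ D')]
      fourierL1 M D D' p - fourierL1 M D D' q := by
  filter_upwards [ae_restrict_X hM.transpose hD'] with ω hω
  obtain ⟨N, hN⟩ := (digits_spec hω.1).exists_lower_bound
  rw [Pi.sub_apply, fourierL1_eq_coeff, fourierL1_eq_coeff, fourierL1_eq_coeff,
    coeff_sub hM hD hN hp hq hp0 hq0, mul_sub]

theorem tail_anti {m n : ℤ} (h : m ≤ n) : tail M D n ⊆ tail M D m :=
  fun _ ⟨a, ha, h0⟩ => ⟨a, ha, fun j hj => h0 j (hj.trans h)⟩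

/-- Dominated convergence: almost every x has no digits far to the left, hence lies in `tail M D
(-N)` for all large N. -/
theorem tendsto_eLpNorm_sub_indicator_tail (hM : IsDilation M) (hD : IsDigitSet M D)
    {f : (Fin d → ℝ) → ℂ} (hf : MemLp f 2 (volume.restrict (X M D))) :
    Tendsto (fun N : ℕ => eLpNorm (f - (tail M D (-N)).indicator f) 2 (volume.restrict (X M D)))
      atTop (𝓝 0) := by
  have h1 : Tendsto (fun N : ℕ => ∫⁻ x in X M D, ‖(f - (tail M D (-N)).indicator f) x‖ₑ ^ 2)
      atTop (𝓝 (∫⁻ _ in X M D, 0)) := by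
    refine tendsto_lintegral_of_dominated_convergence' (fun x => ‖f x‖ₑ ^ 2) (fun N => ?_)
      (fun N => ae_of_all _ fun x => ?_) ?_ ?_
    · exact ((hf.1.sub (hf.1.indicator (measurableSet_tail hM hD _))).enorm).pow_const 2
    · by_cases hx : x ∈ tail M D (-N) <;> simp [hx]
    · rw [← eLpNorm_two_sq]
      exact ENNReal.pow_ne_top hf.2.ne
    · filter_upwards [ae_restrict_X hM hD] with x hx
      obtain ⟨L, hL⟩ := (digits_spec hx.1).exists_lower_bound
      refine tendsto_const_nhds.congr' ?_
      filter_upwards [eventually_ge_atTop (-L).toNat] with N hN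
      have hxN : x ∈ tail M D (-N) := by
        rw [mem_tail_iff hM hD hx.1 hx.2]
        exact fun j hj => hL j (by omega)
      simp [hxN]
  simp_rw [← eLpNorm_two_sq, lintegral_zero] at h1
  have h2 := ((ENNReal.continuous_rpow_const (y := (1 / 2 : ℝ))).tendsto 0).comp h1
  rw [ENNReal.zero_rpow_of_pos (by norm_num)] at h2
  refine h2.congr fun N => ?_
  rw [Function.comp_apply, ← ENNReal.rpow_natCast, ← ENNReal.rpow_mul]
  norm_num

theorem memLp_truncFourier (hM : IsDilation M) (hD : IsDigitSet M D) (hD' : IsDigitSet Mᵀ D')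
    {f : (Fin d → ℝ) → ℂ} (hf : MemLp f 2 (volume.restrict (X M D))) (l : ℕ) :
    MemLp (truncFourier M D D' l f) 2 (volume.restrict (X Mᵀ D')) := by
  obtain ⟨C, hC, hbound⟩ := exists_eLpNorm_fourierL1_le hM hD hD'
  have h0 : ∀ x ∉ tail M D (-l), (tail M D (-l)).indicator f x = 0 :=
    fun x hx => Set.indicator_of_notMem hx f
  have hm : MemLp ((tail M D (-l)).indicator f) 2 (volume.restrict (X M D)) :=
    hf.indicator (measurableSet_tail hM hD _)
  rw [truncFourier_eq_fourierL1 hM hD]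
  exact ⟨aestronglyMeasurable_fourierL1 hM hD hD' h0,
    (hbound l _ hm h0).trans_lt (ENNReal.mul_lt_top hC.lt_top hm.2)⟩

/-- The Fourier transform of a function in `L²(X)` exists. -/
theorem exists_isFourierL2 (hM : IsDilation M) (hD : IsDigitSet M D) (hD' : IsDigitSet Mᵀ D')
    {f : (Fin d → ℝ) → ℂ} (hf : MemLp f 2 (volume.restrict (X M D))) :
    ∃ F, IsFourierL2 M D D' f F := by
  obtain ⟨C, hC, hbound⟩ := exists_eLpNorm_fourierL1_le hM hD hD'
  set q : ℕ → (Fin d → ℝ) → ℂ := fun n => (tail M D (-n)).indicator f with hqdef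
  have hq : ∀ n, MemLp (q n) 2 (volume.restrict (X M D)) :=
    fun n => hf.indicator (measurableSet_tail hM hD _)
  have hq0 : ∀ n m : ℕ, n ≤ m → ∀ x ∉ tail M D (-m), q n x = 0 := fun n m hnm x hx =>
    Set.indicator_of_notMem (fun h => hx (tail_anti (by omega) h)) f
  have hJ := memLp_truncFourier (D' := D') hM hD hD' hf
  have hcauchy : CauchySeq fun n => (hJ n).toLp := by
    -- For n, m ≥ N both cut-offs equal f on `tail M D (-N)`, so their difference is bounded
    -- pointwise by `f - q N`; the uniform bound then applies at level `max n m`.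
    refine EMetric.cauchySeq_iff_le_tendsto_0.2
      ⟨fun N => C * eLpNorm (f - q N) 2 (volume.restrict (X M D)), fun n m N hn hm => ?_, ?_⟩
    · have hn0 := hq0 n (max n m) (le_max_left _ _)
      have hm0 := hq0 m (max n m) (le_max_right _ _)
      rw [Lp.edist_toLp_toLp, truncFourier_eq_fourierL1 hM hD, truncFourier_eq_fourierL1 hM hD,
        ← eLpNorm_congr_ae (fourierL1_sub_ae hM hD hD' (hq n) (hq m) hn0 hm0)]
      refine (hbound (max n m) _ ((hq n).sub (hq m)) fun x hx => ?_).trans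
        (mul_le_mul_right (eLpNorm_mono fun x => ?_) _)
      · rw [Pi.sub_apply, hn0 x hx, hm0 x hx, sub_zero]
      · by_cases hx : x ∈ tail M D (-N)
        · have hxn : x ∈ tail M D (-n) := tail_anti (by omega) hx
          have hxm : x ∈ tail M D (-m) := tail_anti (by omega) hx
          simp [hqdef, hx, hxn, hxm]
        · by_cases hxn : x ∈ tail M D (-n) <;> by_cases hxm : x ∈ tail M D (-m) <;>
            simp [hqdef, hx, hxn, hxm]
    · have := ENNReal.Tendsto.const_mul (tendsto_eLpNorm_sub_indicator_tail hM hD hf)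
        (Or.inr hC)
      rwa [mul_zero] at this
  obtain ⟨F, hF⟩ := cauchySeq_tendsto_of_complete hcauchy
  refine ⟨F, Lp.memLp F, ?_⟩
  have h := (Lp.tendsto_Lp_iff_tendsto_eLpNorm'' _ hJ F (Lp.memLp F)).1
    (by rwa [Lp.toLp_coeFn])
  exact h

theorem fourierL1_comp_shift (hM : IsDilation M) (hD : IsDigitSet M D) (g : Word D n)
    {f : (Fin d → ℝ) → ℂ} (hf : AEStronglyMeasurable f (volume.restrict (X M D)))
    {ω : Fin d → ℝ} (hω : ω ∈ XPlus Mᵀ D') :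
    fourierL1 M D D' (fun x => f (shift M D g x)) ω =
      fourierL1 M D D' f ω * chiSeq M g (digits Mᵀ D' ω) := by
  obtain ⟨N, hN⟩ := (digits_spec hω).exists_lower_bound
  rw [fourierL1_eq_coeff, fourierL1_eq_coeff, coeff_comp_shift hM hD g hN hf, mul_assoc]

/-- When g has no digits of index at most -l, the cut-off set is invariant under the shift up to a
null set, and the formula for the integral transform applies to the cut-off function. -/
theorem truncFourier_comp_shift (hM : IsDilation M) (hD : IsDigitSet M D) (g : Word D n) {l : ℕ}
    (hg : ∀ j ≤ -(l : ℤ), g j = 0)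
    {f : (Fin d → ℝ) → ℂ} (hf : AEStronglyMeasurable f (volume.restrict (X M D)))
    {ω : Fin d → ℝ} (hω : ω ∈ XPlus Mᵀ D') :
    truncFourier M D D' l (fun x => f (shift M D g x)) ω =
      truncFourier M D D' l f ω * chiSeq M g (digits Mᵀ D' ω) := by
  rw [truncFourier_eq_fourierL1 hM hD, truncFourier_eq_fourierL1 hM hD,
    ← fourierL1_comp_shift hM hD g (hf.indicator (measurableSet_tail hM hD _)) hω,
    fourierL1_eq_coeff, fourierL1_eq_coeff,
    coeff_congr (indicator_tail_comp_shift hM hD g hg f).symm]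

/-- For large l the approximation error is merely multiplied by a function of modulus 1, so its norm
is unchanged. -/
theorem IsFourierL2.comp_shift (hM : IsDilation M) (hD : IsDigitSet M D)
    (hD' : IsDigitSet Mᵀ D') (g : Word D n) {f F : (Fin d → ℝ) → ℂ}
    (hf : AEStronglyMeasurable f (volume.restrict (X M D))) (hF : IsFourierL2 M D D' f F) :
    IsFourierL2 M D D' (fun x => f (shift M D g x))
      fun ω => F ω * chiSeq M g (digits Mᵀ D' ω) := by
  obtain ⟨L, hL⟩ := g.exists_lower_bound
  have hm := aestronglyMeasurable_chiSeq_right hM.transpose hD' (M := M) hL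
  refine ⟨hF.1.of_le (hF.1.1.mul hm) (ae_of_all _ fun ω => ?_), hF.2.congr' ?_⟩
  · rw [norm_mul, norm_chiSeq, mul_one]
  · filter_upwards [eventually_ge_atTop (-L).toNat] with l hl
    refine eLpNorm_congr_norm_ae ?_
    filter_upwards [ae_restrict_X hM.transpose hD'] with ω hω
    rw [truncFourier_comp_shift hM hD g (fun j hj => hL j (by omega)) hf hω.1, ← sub_mul,
      norm_mul, norm_chiSeq, mul_one]

theorem IsFourierL2.ae_eq (hM : IsDilation M) (hD : IsDigitSet M D) (hD' : IsDigitSet Mᵀ D')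
    {f F G : (Fin d → ℝ) → ℂ} (hf : MemLp f 2 (volume.restrict (X M D)))
    (hF : IsFourierL2 M D D' f F) (hG : IsFourierL2 M D D' f G) :
    F =ᵐ[volume.restrict (X Mᵀ D')] G := by
  have hJ := memLp_truncFourier (D' := D') hM hD hD' hf
  have h1 := (Lp.tendsto_Lp_iff_tendsto_eLpNorm'' _ hJ F hF.1).2 hF.2
  have h2 := (Lp.tendsto_Lp_iff_tendsto_eLpNorm'' _ hJ G hG.1).2 hG.2
  exact (MemLp.toLp_eq_toLp_iff _ _).1 (tendsto_nhds_unique h1 h2)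

end

end MPositive

end

theorem mainTheorem12 (d : ℕ) (hd : 1 ≤ d)
    (M : Matrix (Fin d) (Fin d) ℤ) (hM : MPositive.IsDilation M)
    (D D' : Finset (Fin d → ℤ))
    (hD : MPositive.IsDigitSet M D) (hD' : MPositive.IsDigitSet Mᵀ D')
    (f : (Fin d → ℝ) → ℂ) (hf : MemLp f 2 (volume.restrict (MPositive.X M D)))
    (γ : Fin d → ℝ) (hγ : γ ∈ MPositive.H M D) :
    -- the shifted function is defined almost everywhere on `X` and belongs to `L²(X)`
    (∀ᵐ x ∂(volume.restrict (MPositive.X M D)), MPositive.oplus M D x γ ∈ MPositive.X M D) ∧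
    MemLp (fun x => f (MPositive.oplus M D x γ)) 2 (volume.restrict (MPositive.X M D)) ∧
    -- both Fourier transforms exist, and they are related by the character `χ(γ, ·)`
    (∃ F, MPositive.IsFourierL2 M D D' f F) ∧
    (∃ G, MPositive.IsFourierL2 M D D' (fun x => f (MPositive.oplus M D x γ)) G) ∧
    (∀ F G, MPositive.IsFourierL2 M D D' f F →
      MPositive.IsFourierL2 M D D' (fun x => f (MPositive.oplus M D x γ)) G →
      ∀ᵐ ω ∂(volume.restrict (MPositive.X Mᵀ D')), G ω = F ω * MPositive.chi M D D' γ ω) ∧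
    -- for integrable `f` the transforms are given by integrals, and equality holds everywhere
    (IntegrableOn f (MPositive.X M D) →
      IntegrableOn (fun x => f (MPositive.oplus M D x γ)) (MPositive.X M D) ∧
      ∀ ω ∈ MPositive.X Mᵀ D',
        MPositive.fourierL1 M D D' (fun x => f (MPositive.oplus M D x γ)) ω =
          MPositive.fourierL1 M D D' f ω * MPositive.chi M D D' γ ω) := by
  open MPositive in
  -- With the digits of γ packed into a word, `oplus` and `chi` unfold to `shift` and `chiSeq`.
  obtain ⟨g, hg⟩ := exists_word_of_mem_H hγ
  have hop : ∀ x, oplus M D x γ = shift M D g x := fun x => by rw [hg]; rfl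
  have hchi : ∀ ω, chi M D D' γ ω = chiSeq M g (digits Mᵀ D' ω) := fun ω => by rw [hg]; rfl
  simp_rw [hop, hchi]
  have hfs := memLp_comp_shift hM hD g hf
  refine ⟨?_, hfs, exists_isFourierL2 hM hD hD' hf, exists_isFourierL2 hM hD hD' hfs,
    fun F G hF hG => ?_, fun hf1 => ⟨?_, fun ω hω => ?_⟩⟩
  · filter_upwards [ae_shift hM hD g (ae_restrict_X hM hD)] with x hx
    exact Or.inl hx
  · exact hG.ae_eq hM hD hD' hfs (hF.comp_shift hM hD hD' g hf.1)
  · exact memLp_one_iff_integrable.1 (memLp_comp_shift hM hD g (memLp_one_iff_integrable.2 hf1))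
  · exact fourierL1_comp_shift hM hD g hf.1 (X_subset_XPlus hω)
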